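/- A tree-like tableau is a filling of a Young diagram (in English notation) with points inside some of its cells such that (1) the top left cell contains a point, called the root point; (2) for each non-root point, there is a point above it in the same column or a point to its left in the same row, but not both; (3) every row and every column contains at least one point. Its size is its number of points, and it is symmetric if it is invariant under reflection in its main diagonal. A corner is a cell of the diagram whose bottom edge and right edge both lie on the Southeast border of the diagram; it is occupied if it contains a point. For a tree-like tableau $T$ let $\mathrm{oc}(T)$ be its number of occupied corners, and let $\mathcal T^{Sym}_{2n+1}$ be the set of symmetric tree-like tableaux of size $2n+1$. Then, for every integer $n\ge 0$, the set $\mathcal T^{Sym}_{2n+1}$ is finite and $$\sum_{T\in\mathcal T^{Sym}_{2n+1}}\mathrm{oc}(T)=2^n\,n!=\bigl|\mathcal T^{Sym}_{2n+1}\bigr|.$$ In other words, on average there is one occupied corner per symmetric tree-like tableau of size $2n+1$. -/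

import Mathlib

open scoped Nat

/-- A tree-like tableau: a Young diagram (English convention, cells `(i, j)` with `i` the row and
`j` the column, both numbered from `0`), some cells of which contain a point. -/
@[ext]
structure TreeLikeTableau where
  /-- the underlying Young diagram -/
  shape : YoungDiagram
  /-- the cells that contain a point -/
  points : Finset (ℕ × ℕ)
  points_subset : points ⊆ shape.cells
  /-- the top left cell has a point, the root point -/
  root_mem : (0, 0) ∈ points
  /-- a non-root point has a point above it in its column or to its left in its row, not both -/
  parent : ∀ i j : ℕ, (i, j) ∈ points → (i, j) ≠ (0, 0) →
    Xor (∃ i' < i, (i', j) ∈ points) (∃ j' < j, (i, j') ∈ points)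
  /-- there is no empty row -/
  row_nonempty : ∀ i j : ℕ, (i, j) ∈ shape → ∃ j', (i, j') ∈ points
  /-- there is no empty column -/
  col_nonempty : ∀ i j : ℕ, (i, j) ∈ shape → ∃ i', (i', j) ∈ points

namespace TreeLikeTableau

/-- The size of a tree-like tableau is its number of points. -/
def size (T : TreeLikeTableau) : ℕ := T.points.card

/-- Invariance (of the diagram and of the points) under reflection in the main diagonal. -/
def IsSymmetric (T : TreeLikeTableau) : Prop :=
  T.shape.transpose = T.shape ∧ ∀ i j : ℕ, (i, j) ∈ T.points ↔ (j, i) ∈ T.points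

/-- The corners: the cells whose bottom and right edges both lie on the Southeast border. -/
def corners (T : TreeLikeTableau) : Finset (ℕ × ℕ) :=
  T.shape.cells.filter fun c => (c.1 + 1, c.2) ∉ T.shape ∧ (c.1, c.2 + 1) ∉ T.shape

/-- The number of occupied corners, i.e. of corners that contain a point. -/
def oc (T : TreeLikeTableau) : ℕ := (T.corners.filter fun c => c ∈ T.points).card

/-- The set of symmetric tree-like tableaux of size `m`. -/
def symTableaux (m : ℕ) : Set TreeLikeTableau := {T | T.size = m ∧ T.IsSymmetric}

end TreeLikeTableau

/-! Row `i` and column `i` of a symmetric diagram form one line, and the half of the border from its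
Northeast end to the main diagonal crosses each line once. With D for a vertical and E for a
horizontal step, diagrams with n + 1 lines become words Dw, w of length n. A filling with m lines
has 2m - 1 points, so size 2n + 1 means n + 1 lines.

Let M(w) be the number of symmetric fillings with half border Dw. A corner DE is either empty, and
its cell can be removed, leaving ED; or occupied with its parent above (left), and then it is alone
in its row (column), which can be deleted. So M(xDEy) = M(xEDy) + M(xEy) + M(xDy)
(`card_wordFillings_corner`). A corner in the first row is always occupied, so M(Ey) = M(y). A
diagonal cell other than the root is always empty, so M(xD) = M(xE). Let S_n be the sum of M over
words of length n. Moving D through (D + E)^n gives S_{n+1} = 2(n + 1) S_n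
(`sum_words_of_recurrence`), hence S_n = 2^n n!.

The corners use the same moves. Fix the distance t from a corner DE to the diagonal. Its occupied
fillings are counted by replacing DE with D or with E, so summing over the other letters gives
exactly S_n for diagrams with n + 2 lines (`sum_cornerCount`). There are n + 1 values of t and two
mirror halves: 2(n + 1) S_n = S_{n+1} occupied corners in all. Only the one-cell tableau has an
occupied diagonal corner. Finally, `labelledPoints_bijOn` identifies tableaux with fillings of
words. -/

/-- A symmetric set `P` of points in the cells `C a b` with rows and columns indexed by `A`,
satisfying the axioms of a tree-like tableau with root `(r, r)`. -/
structure IsSymFilling {α : Type*} [LinearOrder α] (r : α) (A : Finset α) (C : α → α → Prop)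
    (P : Finset (α × α)) : Prop where
  mem : ∀ a b, (a, b) ∈ P → a ∈ A
  cell : ∀ a b, (a, b) ∈ P → C a b
  symm : ∀ a b, (a, b) ∈ P → (b, a) ∈ P
  root : (r, r) ∈ P
  root_le : ∀ a ∈ A, r ≤ a
  parent : ∀ a b, (a, b) ∈ P → (a, b) ≠ (r, r) →
    Xor (∃ a' < a, (a', b) ∈ P) (∃ b' < b, (a, b') ∈ P)
  line : ∀ a ∈ A, ∃ b, (a, b) ∈ P

open Classical in
/-- The finite set of symmetric fillings. -/
noncomputable def symFillings {α : Type*} [LinearOrder α] (r : α) (A : Finset α)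
    (C : α → α → Prop) : Finset (Finset (α × α)) :=
  (A ×ˢ A).powerset.filter (IsSymFilling r A C)

/-! ### Symmetric fillings over an ordered set of lines: deleting, inserting and relabelling lines
-/

section Fillings

variable {α β : Type*} [LinearOrder α] [LinearOrder β] {r : α} {A : Finset α}
  {C : α → α → Prop} {P : Finset (α × α)}

theorem IsSymFilling.mem_right (h : IsSymFilling r A C P) {a b : α} (hab : (a, b) ∈ P) : b ∈ A :=
  h.mem b a (h.symm a b hab)

theorem IsSymFilling.subset (h : IsSymFilling r A C P) : P ⊆ A ×ˢ A := fun p hp =>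
  Finset.mem_product.2 ⟨h.mem p.1 p.2 hp, h.mem_right (a := p.1) (b := p.2) hp⟩

@[simp]
theorem mem_symFillings : P ∈ symFillings r A C ↔ IsSymFilling r A C P := by
  simp only [symFillings, Finset.mem_filter, Finset.mem_powerset, and_iff_right_iff_imp]
  exact fun h => h.subset

/-- By symmetry a diagonal point has a point above it exactly when it has one to its left, against
the exclusive alternative. -/
theorem IsSymFilling.diag_notMem (h : IsSymFilling r A C P) {i : α} (hi : i ≠ r) :
    (i, i) ∉ P := by
  intro hP
  have := h.parent i i hP (by simp [hi])
  have e : (∃ a' < i, (a', i) ∈ P) ↔ (∃ b' < i, (i, b') ∈ P) :=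
    ⟨fun ⟨a, ha, h'⟩ => ⟨a, ha, h.symm _ _ h'⟩, fun ⟨a, ha, h'⟩ => ⟨a, ha, h.symm _ _ h'⟩⟩
  rw [e] at this
  rcases this with h | h
  · exact h.2 h.1
  · exact h.2 h.1

/-- Deleting an occupied corner whose parent is above it, together with its row. -/
theorem IsSymFilling.erase_line (h : IsSymFilling r A C P) {i j : α} (hij : i ≠ j)
    (hrow : ∀ b ∈ A, C i b → b ≤ j) (hcol : ∀ a ∈ A, C a j → a ≤ i)
    (hP : (i, j) ∈ P) (habove : ∃ a' < i, (a', j) ∈ P) :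
    IsSymFilling r (A.erase i) C ((P.erase (i, j)).erase (j, i)) := by
  have hir : i ≠ r := by
    rintro rfl
    obtain ⟨a, ha, haP⟩ := habove
    exact absurd (h.root_le a (h.mem _ _ haP)) (not_le.2 ha)
  have hnl : ¬ ∃ b' < j, (i, b') ∈ P := by
    have := h.parent i j hP (by simp [hir])
    rcases this with ⟨_, h2⟩ | ⟨_, h2⟩
    · exact h2
    · exact absurd habove h2
  -- The corner ends its row and has nothing to its left, so it is alone there.
  have hone : ∀ b, (i, b) ∈ P → b = j := by
    intro b hb
    refine le_antisymm (hrow b (h.mem_right hb) (h.cell _ _ hb)) ?_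
    by_contra hlt
    exact hnl ⟨b, not_le.1 hlt, hb⟩
  have hone' : ∀ b, (b, i) ∈ P → b = j := fun b hb => hone b (h.symm _ _ hb)
  have hmem : ∀ a b, (a, b) ∈ (P.erase (i, j)).erase (j, i) ↔ (a, b) ∈ P ∧ a ≠ i ∧ b ≠ i := by
    intro a b
    simp only [Finset.mem_erase, ne_eq, Prod.mk.injEq]
    constructor
    · rintro ⟨h1, h2, h3⟩
      refine ⟨h3, ?_, ?_⟩
      · rintro rfl; exact h2 ⟨rfl, hone _ h3⟩
      · rintro rfl; exact h1 ⟨hone' _ h3, rfl⟩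
    · rintro ⟨h1, h2, h3⟩
      exact ⟨fun hh => h3 hh.2, fun hh => h2 hh.1, h1⟩
  refine ⟨?_, ?_, ?_, ?_, ?_, ?_, ?_⟩
  · intro a b hab
    rw [hmem] at hab
    exact Finset.mem_erase.2 ⟨hab.2.1, h.mem _ _ hab.1⟩
  · intro a b hab
    rw [hmem] at hab
    exact h.cell _ _ hab.1
  · intro a b hab
    rw [hmem] at hab ⊢
    exact ⟨h.symm _ _ hab.1, hab.2.2, hab.2.1⟩
  · rw [hmem]
    exact ⟨h.root, hir.symm, hir.symm⟩
  · exact fun a ha => h.root_le a (Finset.mem_of_mem_erase ha)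
  · intro a b hab hne
    rw [hmem] at hab
    -- No remaining point loses a parent: the deleted point of row `i` is in column `j`, which has
    -- no cell below it.
    have e1 : (∃ a' < a, (a', b) ∈ (P.erase (i, j)).erase (j, i)) ↔ ∃ a' < a, (a', b) ∈ P := by
      constructor
      · rintro ⟨a', h1, h2⟩
        exact ⟨a', h1, ((hmem _ _).1 h2).1⟩
      · rintro ⟨a', h1, h2⟩
        refine ⟨a', h1, (hmem _ _).2 ⟨h2, ?_, hab.2.2⟩⟩
        rintro rfl
        have := hone _ h2
        subst this
        exact absurd (hcol a (h.mem _ _ hab.1) (h.cell _ _ hab.1)) (not_le.2 h1)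
    have e2 : (∃ b' < b, (a, b') ∈ (P.erase (i, j)).erase (j, i)) ↔ ∃ b' < b, (a, b') ∈ P := by
      constructor
      · rintro ⟨a', h1, h2⟩
        exact ⟨a', h1, ((hmem _ _).1 h2).1⟩
      · rintro ⟨a', h1, h2⟩
        refine ⟨a', h1, (hmem _ _).2 ⟨h2, hab.2.1, ?_⟩⟩
        rintro rfl
        have := hone' _ h2
        subst this
        exact absurd (hcol b (h.mem_right hab.1) (h.cell _ _ (h.symm _ _ hab.1))) (not_le.2 h1)
    rw [e1, e2]
    exact h.parent a b hab.1 hne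
  · intro a ha
    rw [Finset.mem_erase] at ha
    obtain ⟨b, hb⟩ := h.line a ha.2
    -- If the witness is in the deleted column then `a = j`, and the mirror image of the parent of
    -- `(i, j)` replaces it.
    by_cases hbi : b = i
    · subst hbi
      have := hone' _ hb
      subst this
      obtain ⟨a', h1, h2⟩ := habove
      exact ⟨a', (hmem _ _).2 ⟨h.symm _ _ h2, hij.symm, h1.ne⟩⟩
    · exact ⟨b, (hmem _ _).2 ⟨hb, ha.1, hbi⟩⟩

/-- Inserting a row that carries a single point, in a corner. -/
theorem IsSymFilling.insert_line {i j : α} (h : IsSymFilling r (A.erase i) C P) (hij : i ≠ j)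
    (hi : i ∈ A) (hj : j ∈ A) (hri : r ≤ i) (hC : C i j) (hC' : C j i)
    (hcol : ∀ a ∈ A, C a j → a ≤ i) :
    IsSymFilling r A C (insert (j, i) (insert (i, j) P)) ∧
      ∃ a' < i, (a', j) ∈ insert (j, i) (insert (i, j) P) := by
  have hnot : ∀ b, (i, b) ∉ P := fun b hb => by simpa using h.mem _ _ hb
  have hnot' : ∀ b, (b, i) ∉ P := fun b hb => hnot b (h.symm _ _ hb)
  have hmem : ∀ a b, (a, b) ∈ insert (j, i) (insert (i, j) P) ↔
      (a = j ∧ b = i) ∨ (a = i ∧ b = j) ∨ (a, b) ∈ P := by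
    intro a b; simp
  -- Line `j` already carries a point; its mirror image lies in column `j`, which ends at row `i`,
  -- hence above the new corner.
  have habove : ∃ a' < i, (a', j) ∈ P := by
    obtain ⟨b, hb⟩ := h.line j (Finset.mem_erase.2 ⟨hij.symm, hj⟩)
    have hb' := h.symm _ _ hb
    have hbA := Finset.mem_erase.1 (h.mem _ _ hb')
    exact ⟨b, lt_of_le_of_ne (hcol b hbA.2 (h.cell _ _ hb')) hbA.1, hb'⟩
  refine ⟨⟨?_, ?_, ?_, ?_, ?_, ?_, ?_⟩, ?_⟩
  · intro a b hab
    rcases (hmem _ _).1 hab with ⟨rfl, rfl⟩ | ⟨rfl, rfl⟩ | hab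
    · exact hj
    · exact hi
    · exact Finset.mem_of_mem_erase (h.mem _ _ hab)
  · intro a b hab
    rcases (hmem _ _).1 hab with ⟨rfl, rfl⟩ | ⟨rfl, rfl⟩ | hab
    · exact hC'
    · exact hC
    · exact h.cell _ _ hab
  · intro a b hab
    rw [hmem]
    rcases (hmem _ _).1 hab with ⟨rfl, rfl⟩ | ⟨rfl, rfl⟩ | hab
    · simp
    · simp
    · exact Or.inr (Or.inr (h.symm _ _ hab))
  · rw [hmem]
    exact Or.inr (Or.inr h.root)
  · intro a ha
    by_cases hai : a = i
    · exact hai ▸ hri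
    · exact h.root_le a (Finset.mem_erase.2 ⟨hai, ha⟩)
  · intro a b hab hne
    simp only [hmem]
    rcases (hmem _ _).1 hab with ⟨rfl, rfl⟩ | ⟨rfl, rfl⟩ | hp
    · right
      constructor
      · obtain ⟨a', h1, h2⟩ := habove
        exact ⟨a', h1, Or.inr (Or.inr (h.symm _ _ h2))⟩
      · rintro ⟨a', h1, h2⟩
        rcases h2 with h2 | h2 | h2
        · exact h1.ne h2.1
        · exact hij h2.2
        · exact hnot' _ h2
    · left
      constructor
      · obtain ⟨a', h1, h2⟩ := habove
        exact ⟨a', h1, Or.inr (Or.inr h2)⟩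
      · rintro ⟨a', h1, h2⟩
        rcases h2 with h2 | h2 | h2
        · exact hij h2.1
        · exact h1.ne h2.2
        · exact hnot _ h2
    · have hbi : b ≠ i := by rintro rfl; exact hnot' _ hp
      have hai : a ≠ i := by rintro rfl; exact hnot _ hp
      have e1 : (∃ a' < a, a' = j ∧ b = i ∨ a' = i ∧ b = j ∨ (a', b) ∈ P) ↔
          ∃ a' < a, (a', b) ∈ P := by
        constructor
        · rintro ⟨a', h1, h2 | h2 | h2⟩
          · exact absurd h2.2 hbi
          · obtain ⟨rfl, rfl⟩ := h2
            exact absurd (hcol a (Finset.mem_of_mem_erase (h.mem _ _ hp)) (h.cell _ _ hp))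
              (not_le.2 h1)
          · exact ⟨a', h1, h2⟩
        · rintro ⟨a', h1, h2⟩
          exact ⟨a', h1, Or.inr (Or.inr h2)⟩
      have e2 : (∃ b' < b, a = j ∧ b' = i ∨ a = i ∧ b' = j ∨ (a, b') ∈ P) ↔
          ∃ b' < b, (a, b') ∈ P := by
        constructor
        · rintro ⟨a', h1, h2 | h2 | h2⟩
          · obtain ⟨rfl, rfl⟩ := h2
            exact absurd (hcol b (Finset.mem_of_mem_erase (h.mem_right hp))
              (h.cell _ _ (h.symm _ _ hp))) (not_le.2 h1)
          · exact absurd h2.1 hai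
          · exact ⟨a', h1, h2⟩
        · rintro ⟨a', h1, h2⟩
          exact ⟨a', h1, Or.inr (Or.inr h2)⟩
      rw [e1, e2]
      exact h.parent a b hp hne
  · intro a ha
    by_cases hai : a = i
    · exact ⟨j, (hmem _ _).2 (Or.inr (Or.inl ⟨hai, rfl⟩))⟩
    · obtain ⟨b, hb⟩ := h.line a (Finset.mem_erase.2 ⟨hai, ha⟩)
      exact ⟨b, (hmem _ _).2 (Or.inr (Or.inr hb))⟩
  · obtain ⟨a', h1, h2⟩ := habove
    exact ⟨a', h1, (hmem _ _).2 (Or.inr (Or.inr h2))⟩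

open Classical in
-- Deletion and insertion of line `i` are inverse to each other, since its only points are the
-- corner and the mirror image.
theorem card_symFillings_corner_above {i j : α} (hij : i ≠ j) (hi : i ∈ A) (hj : j ∈ A)
    (hr : ∀ a ∈ A, r ≤ a) (hC : C i j) (hC' : C j i)
    (hrow : ∀ b ∈ A, C i b → b ≤ j) (hcol : ∀ a ∈ A, C a j → a ≤ i) :
    ((symFillings r A C).filter fun P => (i, j) ∈ P ∧ ∃ a' < i, (a', j) ∈ P).card =
      (symFillings r (A.erase i) C).card := by
  refine Finset.card_nbij' (fun P => (P.erase (i, j)).erase (j, i))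
    (fun P => insert (j, i) (insert (i, j) P)) ?_ ?_ ?_ ?_
  · intro P hP
    simp only [Finset.coe_filter, Set.mem_ofPred_eq, mem_symFillings] at hP
    simpa using hP.1.erase_line hij hrow hcol hP.2.1 hP.2.2
  · intro P hP
    simp only [Finset.mem_coe, mem_symFillings] at hP
    have := hP.insert_line hij hi hj (hr i hi) hC hC' hcol
    simp only [Finset.coe_filter, Set.mem_ofPred_eq, mem_symFillings]
    exact ⟨this.1, by simp, this.2⟩
  · intro P hP
    simp only [Finset.coe_filter, Set.mem_ofPred_eq, mem_symFillings] at hP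
    have h1 : (i, j) ≠ (j, i) := by simp [hij]
    have h2 := hP.1.symm _ _ hP.2.1
    ext ⟨a, b⟩
    simp only [Finset.mem_insert, Finset.mem_erase]
    by_cases h3 : (a, b) = (j, i)
    · simp [h3, h2]
    · by_cases h4 : (a, b) = (i, j)
      · simp [h4, hP.2.1]
      · simp [h3, h4]
  · intro P hP
    simp only [Finset.mem_coe, mem_symFillings] at hP
    have hnot : ∀ b, (i, b) ∉ P := fun b hb => by simpa using hP.mem _ _ hb
    have hnot' : (j, i) ∉ P := fun hb => hnot j (hP.symm _ _ hb)
    ext ⟨a, b⟩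
    simp only [Finset.mem_insert, Finset.mem_erase]
    by_cases h3 : (a, b) = (j, i)
    · simp [h3, hnot']
    · by_cases h4 : (a, b) = (i, j)
      · simp [h4, hnot]
      · simp [h3, h4]

open Classical in
/-- The fillings in which a given off-diagonal corner is occupied. -/
theorem card_symFillings_corner_mem {i j : α} (hij : i ≠ j) (hi : i ∈ A) (hj : j ∈ A)
    (hir : i ≠ r) (hr : ∀ a ∈ A, r ≤ a) (hC : C i j) (hC' : C j i)
    (hrow : ∀ b ∈ A, C i b → b ≤ j) (hcol : ∀ a ∈ A, C a j → a ≤ i)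
    (hrow' : ∀ b ∈ A, C b i → b ≤ j) (hcol' : ∀ a ∈ A, C j a → a ≤ i) :
    ((symFillings r A C).filter fun P => (i, j) ∈ P).card =
      (symFillings r (A.erase i) C).card + (symFillings r (A.erase j) C).card := by
  rw [← card_symFillings_corner_above hij hi hj hr hC hC' hrow hcol,
    ← card_symFillings_corner_above hij.symm hj hi hr hC' hC hcol' hrow',
    ← Finset.card_union_of_disjoint]
  · congr 1
    ext P
    simp only [Finset.mem_filter, Finset.mem_union, mem_symFillings]
    constructor
    · rintro ⟨h, hP⟩
      rcases h.parent i j hP (by simp [hir]) with h1 | h1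
      · exact Or.inl ⟨h, hP, h1.1⟩
      -- A point to the left of `(i, j)` mirrors to a point above `(j, i)`.
      · obtain ⟨b, hb, hb'⟩ := h1.1
        exact Or.inr ⟨h, h.symm _ _ hP, b, hb, h.symm _ _ hb'⟩
    · rintro (⟨h, hP, _⟩ | ⟨h, hP, _⟩)
      · exact ⟨h, hP⟩
      · exact ⟨h, h.symm _ _ hP⟩
  · rw [Finset.disjoint_left]
    intro P h1 h2
    simp only [Finset.mem_filter, mem_symFillings] at h1 h2
    obtain ⟨h, hP, h3⟩ := h1
    obtain ⟨_, _, b, hb, hb'⟩ := h2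
    rcases h.parent i j hP (by simp [hir]) with h4 | h4
    · exact h4.2 ⟨b, hb, h.symm _ _ hb'⟩
    · exact h4.2 h3

open Classical in
/-- A corner in the first row is always occupied. -/
theorem card_symFillings_root_corner {j : α} (hj : j ∈ A) (hrA : r ∈ A) (hjr : r ≠ j)
    (hr : ∀ a ∈ A, r ≤ a) (hC : C r j) (hC' : C j r)
    (hrow : ∀ b ∈ A, C b r → b ≤ j) (hcol : ∀ a ∈ A, C a j → a ≤ r)
    (hcol' : ∀ a ∈ A, C j a → a ≤ r) :
    (∀ P ∈ symFillings r A C, (r, j) ∈ P) ∧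
      (symFillings r A C).card = (symFillings r (A.erase j) C).card := by
  have hall : ∀ P ∈ symFillings r A C, (r, j) ∈ P := by
    intro P hP
    rw [mem_symFillings] at hP
    obtain ⟨b, hb⟩ := hP.line j hj
    have h1 := hcol' b (hP.mem_right hb) (hP.cell _ _ hb)
    have h2 := hr b (hP.mem_right hb)
    obtain rfl := le_antisymm h1 h2
    exact hP.symm _ _ hb
  refine ⟨hall, ?_⟩
  -- The mirror corner `(j, r)` has the root above it, so all fillings fall under the previous count
  -- with `j` as the deleted line.
  rw [← card_symFillings_corner_above hjr.symm hj hrA hr hC' hC hcol' hrow]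
  congr 1
  ext P
  rw [Finset.mem_filter]
  refine ⟨fun h => ⟨h, ?_, ?_⟩, fun h => h.1⟩
  · exact (mem_symFillings.1 h).symm _ _ (hall P h)
  · exact ⟨r, lt_of_le_of_ne (hr j hj) hjr, (mem_symFillings.1 h).root⟩

/-- Fillings are transported by strictly monotone relabellings of the lines. -/
theorem IsSymFilling.image [DecidableEq (β × β)] {C' : β → β → Prop} {f : α → β}
    (h : IsSymFilling r A C P) (hf : StrictMonoOn f A)
    (hC : ∀ a b, (a, b) ∈ P → C' (f a) (f b)) :
    IsSymFilling (f r) (A.image f) C' (P.image (Prod.map f f)) := by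
  have hmem : ∀ x y, (x, y) ∈ P.image (Prod.map f f) ↔
      ∃ a b, (a, b) ∈ P ∧ f a = x ∧ f b = y := by
    intro x y; simp
  have hrA : r ∈ A := h.mem _ _ h.root
  refine ⟨?_, ?_, ?_, ?_, ?_, ?_, ?_⟩
  · intro x y hxy
    obtain ⟨a, b, hab, rfl, rfl⟩ := (hmem _ _).1 hxy
    exact Finset.mem_image_of_mem _ (h.mem _ _ hab)
  · intro x y hxy
    obtain ⟨a, b, hab, rfl, rfl⟩ := (hmem _ _).1 hxy
    exact hC _ _ hab
  · intro x y hxy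
    obtain ⟨a, b, hab, rfl, rfl⟩ := (hmem _ _).1 hxy
    exact (hmem _ _).2 ⟨b, a, h.symm _ _ hab, rfl, rfl⟩
  · exact (hmem _ _).2 ⟨r, r, h.root, rfl, rfl⟩
  · intro x hx
    obtain ⟨a, ha, rfl⟩ := Finset.mem_image.1 hx
    exact hf.monotoneOn hrA ha (h.root_le a ha)
  · intro x y hxy hne
    obtain ⟨a, b, hab, rfl, rfl⟩ := (hmem _ _).1 hxy
    have ha := h.mem _ _ hab
    have hb := h.mem_right hab
    have e1 : (∃ x' < f a, (x', f b) ∈ P.image (Prod.map f f)) ↔ ∃ a' < a, (a', b) ∈ P := by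
      constructor
      · rintro ⟨x', h1, h2⟩
        obtain ⟨a', b', h3, rfl, h4⟩ := (hmem _ _).1 h2
        obtain rfl := hf.injOn (h.mem_right h3) hb h4
        exact ⟨a', (hf.lt_iff_lt (h.mem _ _ h3) ha).1 h1, h3⟩
      · rintro ⟨a', h1, h2⟩
        exact ⟨f a', hf (h.mem _ _ h2) ha h1, (hmem _ _).2 ⟨a', b, h2, rfl, rfl⟩⟩
    have e2 : (∃ y' < f b, (f a, y') ∈ P.image (Prod.map f f)) ↔ ∃ b' < b, (a, b') ∈ P := by
      constructor
      · rintro ⟨x', h1, h2⟩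
        obtain ⟨a', b', h3, h4, rfl⟩ := (hmem _ _).1 h2
        obtain rfl := hf.injOn (h.mem _ _ h3) ha h4
        exact ⟨b', (hf.lt_iff_lt (h.mem_right h3) hb).1 h1, h3⟩
      · rintro ⟨b', h1, h2⟩
        exact ⟨f b', hf (h.mem_right h2) hb h1, (hmem _ _).2 ⟨a, b', h2, rfl, rfl⟩⟩
    rw [e1, e2]
    refine h.parent a b hab ?_
    rintro hh
    simp only [Prod.mk.injEq] at hh
    exact hne (by rw [hh.1, hh.2])
  · intro x hx
    obtain ⟨a, ha, rfl⟩ := Finset.mem_image.1 hx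
    obtain ⟨b, hb⟩ := h.line a ha
    exact ⟨f b, (hmem _ _).2 ⟨a, b, hb, rfl, rfl⟩⟩

theorem exists_strictMonoOn_leftInverse {f : α → β} (hf : StrictMonoOn f A) (hA : A.Nonempty) :
    ∃ g : β → α, StrictMonoOn g (A.image f : Finset β) ∧ ∀ a ∈ A, g (f a) = a := by
  have : Nonempty α := ⟨hA.choose⟩
  have hinv : ∀ a ∈ A, Function.invFunOn f A (f a) = a := fun a ha =>
    Function.invFunOn_apply_eq (f := f) (s := (A : Set α)) ha |> fun h =>
      hf.injOn (Function.invFunOn_mem ⟨a, ha, rfl⟩) ha h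
  refine ⟨Function.invFunOn f A, ?_, hinv⟩
  intro x hx y hy hxy
  obtain ⟨a, ha, rfl⟩ := Finset.mem_image.1 hx
  obtain ⟨b, hb, rfl⟩ := Finset.mem_image.1 hy
  rw [hinv a ha, hinv b hb]
  exact (hf.lt_iff_lt ha hb).1 hxy

open Classical in
-- The axioms see only the order of the lines. The relabelling may lose cells, so the fillings that
-- survive are those whose points avoid the lost cells.
theorem card_symFillings_image {C' : β → β → Prop} {f : α → β} (hrA : r ∈ A)
    (hf : StrictMonoOn f A) (hC' : ∀ a ∈ A, ∀ b ∈ A, C' (f a) (f b) → C a b) :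
    (symFillings (f r) (A.image f) C').card =
      ((symFillings r A C).filter fun P => ∀ a b, (a, b) ∈ P → C' (f a) (f b)).card := by
  obtain ⟨g, hg, hgf⟩ := exists_strictMonoOn_leftInverse hf ⟨r, hrA⟩
  have himg : (A.image f).image g = A := by
    ext a
    simp only [Finset.mem_image]
    constructor
    · rintro ⟨_, ⟨b, hb, rfl⟩, rfl⟩
      rwa [hgf b hb]
    · intro ha
      exact ⟨f a, ⟨a, ha, rfl⟩, hgf a ha⟩
  have hfg : ∀ x ∈ A.image f, f (g x) = x := by
    intro x hx
    obtain ⟨a, ha, rfl⟩ := Finset.mem_image.1 hx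
    rw [hgf a ha]
  have hback : ∀ P', IsSymFilling (f r) (A.image f) C' P' →
      (P'.image (Prod.map g g)).image (Prod.map f f) = P' := by
    intro P' h
    rw [Finset.image_image]
    refine (Finset.image_congr (g := id) ?_).trans Finset.image_id
    rintro ⟨x, y⟩ hxy
    simp [hfg x (h.mem _ _ hxy), hfg y (h.mem_right hxy)]
  have hfor : ∀ P, IsSymFilling r A C P →
      (P.image (Prod.map f f)).image (Prod.map g g) = P := by
    intro P h
    rw [Finset.image_image]
    refine (Finset.image_congr (g := id) ?_).trans Finset.image_id
    rintro ⟨x, y⟩ hxy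
    simp [hgf x (h.mem _ _ hxy), hgf y (h.mem_right hxy)]
  refine Finset.card_nbij' (fun P => P.image (Prod.map g g)) (fun P => P.image (Prod.map f f))
    ?_ ?_ ?_ ?_
  · intro P hP
    simp only [Finset.mem_coe, mem_symFillings] at hP
    have hcell : ∀ x y, (x, y) ∈ P → C' (f (g x)) (f (g y)) := by
      intro x y hxy
      rw [hfg x (hP.mem _ _ hxy), hfg y (hP.mem_right hxy)]
      exact hP.cell _ _ hxy
    have hmemA : ∀ x ∈ A.image f, g x ∈ A := fun x hx => himg ▸ Finset.mem_image_of_mem g hx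
    have h2 := hP.image (C' := C) hg fun x y hxy =>
      hC' _ (hmemA _ (hP.mem _ _ hxy)) _ (hmemA _ (hP.mem_right hxy)) (hcell _ _ hxy)
    rw [himg, hgf r hrA] at h2
    simp only [Finset.coe_filter, Set.mem_ofPred_eq, mem_symFillings]
    refine ⟨h2, ?_⟩
    intro a b hab
    obtain ⟨⟨x, y⟩, hxy, he⟩ := Finset.mem_image.1 hab
    simp only [Prod.map_apply, Prod.mk.injEq] at he
    obtain ⟨rfl, rfl⟩ := he
    exact hcell _ _ hxy
  · intro P hP
    simp only [Finset.coe_filter, Set.mem_ofPred_eq, mem_symFillings] at hP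
    simp only [Finset.mem_coe, mem_symFillings]
    exact hP.1.image hf hP.2
  · intro P hP
    simp only [Finset.mem_coe, mem_symFillings] at hP
    exact hback P hP
  · intro P hP
    simp only [Finset.coe_filter, Set.mem_ofPred_eq, mem_symFillings] at hP
    exact hfor P hP.1

/-- A symmetric filling with `m` lines has `2 * m - 1` points. -/
theorem IsSymFilling.card_add_one (h : IsSymFilling r A C P) : P.card + 1 = 2 * A.card := by
  classical
  have hrA : r ∈ A := h.mem _ _ h.root
  set U := P.filter fun p => ∃ a' < p.1, (a', p.2) ∈ P with hU
  set L := P.filter fun p => ∃ b' < p.2, (p.1, b') ∈ P with hL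
  have hne : ∀ a b, (∃ a' < a, (a', b) ∈ P) → (a, b) ≠ (r, r) := by
    rintro a b ⟨a', h1, h2⟩ he
    simp only [Prod.mk.injEq] at he
    exact absurd (h.root_le a' (h.mem _ _ h2)) (not_le.2 (he.1 ▸ h1))
  have hne' : ∀ a b, (∃ b' < b, (a, b') ∈ P) → (a, b) ≠ (r, r) := by
    rintro a b ⟨a', h1, h2⟩ he
    simp only [Prod.mk.injEq] at he
    exact absurd (h.root_le a' (h.mem_right h2)) (not_le.2 (he.2 ▸ h1))
  -- Each row except the root's has exactly one point with a point above it: its leftmost point.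
  have hUc : U.card = (A.erase r).card := by
    refine Finset.card_nbij (fun p => p.1) ?_ ?_ ?_
    · rintro ⟨a, b⟩ hp
      simp only [hU, Finset.coe_filter, Set.mem_ofPred_eq] at hp
      obtain ⟨hp, a', h1, h2⟩ := hp
      simp only [Finset.coe_erase, Set.mem_sdiff, Finset.mem_coe, Set.mem_singleton_iff]
      exact ⟨h.mem _ _ hp, fun he =>
        absurd (h.root_le a' (h.mem _ _ h2)) (not_le.2 (he ▸ h1))⟩
    · rintro ⟨a, b⟩ hp ⟨a', b'⟩ hp' (rfl : a = a')
      simp only [hU, Finset.coe_filter, Set.mem_ofPred_eq] at hp hp'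
      have key : ∀ b b', (a, b) ∈ P → (a, b') ∈ P → (∃ a' < a, (a', b') ∈ P) → ¬ b < b' := by
        intro b b' h1 h2 h3 h4
        rcases h.parent a b' h2 (hne _ _ h3) with h5 | h5
        · exact h5.2 ⟨b, h4, h1⟩
        · exact h5.2 h3
      have := le_antisymm (not_lt.1 (key b' b hp'.1 hp.1 hp.2))
        (not_lt.1 (key b b' hp.1 hp'.1 hp'.2))
      rw [this]
    · intro a ha
      simp only [Finset.coe_erase, Set.mem_sdiff, Finset.mem_coe, Set.mem_singleton_iff] at ha
      obtain ⟨b, hb, hmin⟩ := Finset.exists_min_image (A.filter fun b => (a, b) ∈ P) id (by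
        obtain ⟨b, hb⟩ := h.line a ha.1
        exact ⟨b, Finset.mem_filter.2 ⟨h.mem_right hb, hb⟩⟩)
      rw [Finset.mem_filter] at hb
      refine ⟨(a, b), ?_, rfl⟩
      simp only [hU, Finset.coe_filter, Set.mem_ofPred_eq]
      refine ⟨hb.2, ?_⟩
      rcases h.parent a b hb.2 (by simp [ha.2]) with h5 | h5
      · exact h5.1
      · obtain ⟨b', h6, h7⟩ := h5.1
        exact absurd (hmin b' (Finset.mem_filter.2 ⟨h.mem_right h7, h7⟩)) (not_le.2 h6)
  have hLc : L.card = U.card := by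
    refine Finset.card_nbij' Prod.swap Prod.swap ?_ ?_ (fun _ _ => rfl) (fun _ _ => rfl)
    · rintro ⟨a, b⟩ hp
      simp only [hL, Finset.coe_filter, Set.mem_ofPred_eq] at hp
      obtain ⟨hp, b', h1, h2⟩ := hp
      simp only [hU, Finset.coe_filter, Set.mem_ofPred_eq, Prod.swap_prod_mk]
      exact ⟨h.symm _ _ hp, b', h1, h.symm _ _ h2⟩
    · rintro ⟨a, b⟩ hp
      simp only [hU, Finset.coe_filter, Set.mem_ofPred_eq] at hp
      obtain ⟨hp, b', h1, h2⟩ := hp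
      simp only [hL, Finset.coe_filter, Set.mem_ofPred_eq, Prod.swap_prod_mk]
      exact ⟨h.symm _ _ hp, b', h1, h.symm _ _ h2⟩
  have hdisj : Disjoint U L := by
    rw [Finset.disjoint_left]
    rintro ⟨a, b⟩ h1 h2
    simp only [hU, hL, Finset.mem_filter] at h1 h2
    rcases h.parent a b h1.1 (hne _ _ h1.2) with h5 | h5
    · exact h5.2 h2.2
    · exact h5.2 h1.2
  have hPeq : P.erase (r, r) = U ∪ L := by
    ext ⟨a, b⟩
    simp only [hU, hL, Finset.mem_union, Finset.mem_filter, Finset.mem_erase]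
    constructor
    · rintro ⟨h1, h2⟩
      rcases h.parent a b h2 h1 with h5 | h5
      · exact Or.inl ⟨h2, h5.1⟩
      · exact Or.inr ⟨h2, h5.1⟩
    · rintro (⟨h1, h2⟩ | ⟨h1, h2⟩)
      · exact ⟨hne _ _ h2, h1⟩
      · exact ⟨hne' _ _ h2, h1⟩
  have hc := congrArg Finset.card hPeq
  rw [Finset.card_union_of_disjoint hdisj, Finset.card_erase_of_mem h.root, hLc, hUc,
    Finset.card_erase_of_mem hrA] at hc
  have h1 : 0 < P.card := Finset.card_pos.2 ⟨_, h.root⟩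
  have h2 : 0 < A.card := Finset.card_pos.2 ⟨_, hrA⟩
  omega

end Fillings

/-! ### Border words, line labels, and the three local moves on a border -/

section Labels

/-- The label of a step `b` followed by `t` more steps on the way to the main diagonal. -/
def stepLabel (b : Bool) (t : ℕ) : ℤ := if b then -((t : ℤ) + 1) else (t : ℤ) + 1

/-- The lines of the symmetric diagram whose border, from its Northeast end to the main diagonal,
is `w` (`true` for vertical steps, `false` for horizontal ones). The line met by a step is labelled
by plus or minus the distance to the main diagonal, so that the diagram has a cell at the
intersection of lines `a` and `b` when `a + b < 0`. -/
def lineLabels : List Bool → Finset ℤ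
  | [] => ∅
  | b :: w => insert (stepLabel b w.length) (lineLabels w)

/-- The cells of the diagram, in terms of line labels. -/
def LabelCell (a b : ℤ) : Prop := a + b < 0

/-- The fillings of the symmetric diagram with border `w`. -/
noncomputable def wordFillings (w : List Bool) : Finset (Finset (ℤ × ℤ)) :=
  symFillings (-(w.length : ℤ)) (lineLabels w) LabelCell

theorem lineLabels_bounds {w : List Bool} {a : ℤ} (ha : a ∈ lineLabels w) :
    1 ≤ |a| ∧ |a| ≤ w.length := by
  induction w with
  | nil => simp [lineLabels] at ha
  | cons b w ih =>
    rw [lineLabels, Finset.mem_insert] at ha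
    rcases ha with rfl | ha
    · cases b <;> simp only [stepLabel, abs_le, le_abs, List.length_cons] <;> push_cast <;>
        simp <;> omega
    · have := ih ha
      simp only [List.length_cons]
      push_cast
      omega

/-- Each distance to the diagonal belongs to one step, so it occurs with one sign only. Hence two
labels never sum to `0`. -/
theorem neg_notMem_lineLabels {w : List Bool} {a : ℤ} (ha : a ∈ lineLabels w) :
    -a ∉ lineLabels w := by
  induction w generalizing a with
  | nil => simp [lineLabels] at ha
  | cons b w ih =>
    have key : -stepLabel b w.length ∉ lineLabels w := fun h => by
      have := (lineLabels_bounds h).2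
      cases b <;> simp only [stepLabel, abs_le] at this <;> simp at this
    have h0 : stepLabel b w.length ≠ 0 := by
      simp only [stepLabel]
      split_ifs <;> omega
    rw [lineLabels, Finset.mem_insert] at ha ⊢
    rintro (h | h)
    · rcases ha with ha | ha
      · omega
      · exact key (by rw [← h, neg_neg]; exact ha)
    · rcases ha with ha | ha
      · exact key (ha ▸ h)
      · exact ih ha h

theorem stepLabel_notMem {b : Bool} {x y : List Bool} (h : y.length ≤ x.length) :
    stepLabel b x.length ∉ lineLabels y := fun h' => by
  have := (lineLabels_bounds h').2
  cases b <;> simp [stepLabel, abs_le] at this <;> omega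

/-- Makes room for a line at distance `t + 1` from the main diagonal. -/
def shiftLabel (t : ℕ) (a : ℤ) : ℤ := if |a| ≤ t then a else if a < 0 then a - 1 else a + 1

theorem shiftLabel_lt {t : ℕ} {a b : ℤ} (h : a < b) : shiftLabel t a < shiftLabel t b := by
  simp only [shiftLabel, abs_le]
  split_ifs <;> omega

theorem shiftLabel_add_neg {t : ℕ} {a b : ℤ} :
    shiftLabel t a + shiftLabel t b < 0 ↔ a + b < 0 := by
  simp only [shiftLabel, abs_le]
  split_ifs <;> omega

theorem shiftLabel_stepLabel (b : Bool) {t s : ℕ} (h : t ≤ s) :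
    shiftLabel t (stepLabel b s) = stepLabel b (s + 1) := by
  cases b <;> simp only [shiftLabel, stepLabel, abs_le] <;> simp <;> split_ifs <;> omega

/-- Without the step, the steps before it are one closer to the diagonal; the shift restores their
old distances. -/
theorem lineLabels_erase (x : List Bool) (b : Bool) (y : List Bool) :
    (lineLabels (x ++ b :: y)).erase (stepLabel b y.length) =
      (lineLabels (x ++ y)).image (shiftLabel y.length) := by
  induction x with
  | nil =>
    simp only [List.nil_append, lineLabels]
    rw [Finset.erase_insert (stepLabel_notMem le_rfl)]
    symm
    refine (Finset.image_congr (g := id) ?_).trans Finset.image_id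
    intro a ha
    simp [shiftLabel, (lineLabels_bounds ha).2]
  | cons c x ih =>
    simp only [List.cons_append, lineLabels, Finset.image_insert]
    rw [Finset.erase_insert_of_ne, ih, shiftLabel_stepLabel _ (by simp)]
    · simp [add_assoc]
    · cases c <;> cases b <;> simp [stepLabel] <;> omega

/-- The relabelling that removes the cell at the corner with labels `-(t + 2)` and `t + 1`. -/
def swapLabel (t : ℕ) (a : ℤ) : ℤ :=
  if a = -((t : ℤ) + 2) then -((t : ℤ) + 1) else if a = (t : ℤ) + 1 then (t : ℤ) + 2 else a

theorem lineLabels_swap (x y : List Bool) :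
    (lineLabels (x ++ true :: false :: y)).image (swapLabel y.length) =
      lineLabels (x ++ false :: true :: y) := by
  induction x with
  | nil =>
    simp only [List.nil_append, lineLabels, Finset.image_insert]
    rw [Finset.insert_comm]
    congr 1
    · simp only [stepLabel, swapLabel, List.length_cons]
      push_cast
      split_ifs <;> omega
    · congr 1
      · simp only [stepLabel, swapLabel, List.length_cons, if_true]
        push_cast
        split_ifs <;> omega
      · refine (Finset.image_congr (g := id) ?_).trans Finset.image_id
        intro a ha
        have := (lineLabels_bounds ha).2
        rw [abs_le] at this
        simp only [swapLabel, id]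
        split_ifs <;> omega
  | cons c x ih =>
    simp only [List.cons_append, lineLabels, Finset.image_insert, ih]
    congr 1
    cases c <;> simp [stepLabel, swapLabel] <;> omega

/-- The relabelling that removes the cell on the main diagonal. -/
def diagLabel (a : ℤ) : ℤ := if a = -1 then 1 else a

theorem lineLabels_diag (x : List Bool) :
    (lineLabels (x ++ [true])).image diagLabel = lineLabels (x ++ [false]) := by
  induction x with
  | nil => simp [lineLabels, stepLabel, diagLabel]
  | cons c x ih =>
    simp only [List.cons_append, lineLabels, Finset.image_insert, ih]
    congr 1
    cases c <;> simp [stepLabel, diagLabel] <;> omega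

theorem root_mem_lineLabels (w : List Bool) :
    -((true :: w).length : ℤ) ∈ lineLabels (true :: w) := by
  simp [lineLabels, stepLabel]

theorem root_le_lineLabels {w : List Bool} {a : ℤ} (ha : a ∈ lineLabels w) :
    -(w.length : ℤ) ≤ a := (abs_le.1 (lineLabels_bounds ha).2).1

theorem stepLabel_mem (x : List Bool) (b : Bool) (y : List Bool) :
    stepLabel b y.length ∈ lineLabels (x ++ b :: y) := by
  induction x with
  | nil => simp [lineLabels]
  | cons c x ih => exact Finset.mem_insert_of_mem ih

/-- The shift preserves the sign of every sum of two labels, so no cell is lost and every filling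
survives. -/
theorem card_symFillings_erase (x : List Bool) (b : Bool) (y : List Bool) :
    (symFillings (-((true :: x ++ b :: y).length : ℤ))
      ((lineLabels (true :: x ++ b :: y)).erase (stepLabel b y.length)) LabelCell).card =
      (wordFillings (true :: x ++ y)).card := by
  classical
  have hr : -((true :: x ++ b :: y).length : ℤ) =
      shiftLabel y.length (-((true :: x ++ y).length : ℤ)) := by
    have := shiftLabel_stepLabel true (t := y.length) (s := (x ++ y).length) (by simp)
    simp only [stepLabel, if_true] at this
    simp only [List.cons_append, List.length_cons] at this ⊢
    push_cast at this ⊢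
    rw [this]
    simp
    ring
  rw [lineLabels_erase, hr, card_symFillings_image, Finset.filter_true_of_mem]
  · rfl
  · intro P hP a b hab
    exact shiftLabel_add_neg.2 ((mem_symFillings.1 hP).cell _ _ hab)
  · exact root_mem_lineLabels _
  · exact fun a _ b _ h => shiftLabel_lt h
  · exact fun a _ b _ h => shiftLabel_add_neg.1 h

open Classical in
theorem card_wordFillings_corner_mem (x y : List Bool) :
    ((wordFillings (true :: x ++ true :: false :: y)).filter fun P =>
      (-((y.length : ℤ) + 2), (y.length : ℤ) + 1) ∈ P).card =
      (wordFillings (true :: x ++ true :: y)).card +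
        (wordFillings (true :: x ++ false :: y)).card := by
  have hi := stepLabel_mem (true :: x) true (false :: y)
  have hj := stepLabel_mem (true :: x ++ [true]) false y
  have h1 := card_symFillings_erase x true (false :: y)
  have h2 := card_symFillings_erase (x ++ [true]) false y
  simp only [List.append_assoc, List.cons_append, List.nil_append] at hj h1 h2 hi ⊢
  have ei : stepLabel true (false :: y).length = -((y.length : ℤ) + 2) := by
    simp [stepLabel]; omega
  have ej : stepLabel false y.length = (y.length : ℤ) + 1 := by simp [stepLabel]
  rw [ei] at hi h1
  rw [ej] at hj h2
  rw [← h1, ← h2, wordFillings, card_symFillings_corner_mem _ hi hj, add_comm]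
  · simp only [List.length_cons, List.length_append, ne_eq, neg_inj]
    push_cast
    omega
  · exact fun a ha => root_le_lineLabels ha
  all_goals first
    | (intro b hb; simp only [LabelCell]; omega)
    | (simp only [LabelCell]; omega)
    | omega

open Classical in
-- Turning DE into ED removes only the corner and its mirror image, which are empty here.
theorem card_wordFillings_corner_notMem (x y : List Bool) :
    ((wordFillings (true :: x ++ true :: false :: y)).filter fun P =>
      ¬ (-((y.length : ℤ) + 2), (y.length : ℤ) + 1) ∈ P).card =
      (wordFillings (true :: x ++ false :: true :: y)).card := by
  have hr : -((true :: x ++ false :: true :: y).length : ℤ) =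
      swapLabel y.length (-((true :: x ++ true :: false :: y).length : ℤ)) := by
    simp only [List.length_cons, List.length_append, swapLabel]
    push_cast
    split_ifs <;> omega
  -- The new labels are opposite to the two old ones, hence unused; this makes `swapLabel` monotone
  -- on the lines and confines the loss to one cell and its mirror image.
  have hij : ∀ {a}, a ∈ lineLabels (true :: x ++ true :: false :: y) →
      a ≠ -((y.length : ℤ) + 1) ∧ a ≠ (y.length : ℤ) + 2 := by
    have hi := stepLabel_mem (true :: x) true (false :: y)
    have hj := stepLabel_mem (true :: x ++ [true]) false y
    simp only [List.append_assoc, List.cons_append, List.nil_append] at hj hi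
    have ei : stepLabel true (false :: y).length = -((y.length : ℤ) + 2) := by
      simp [stepLabel]; omega
    have ej : stepLabel false y.length = (y.length : ℤ) + 1 := by simp [stepLabel]
    rw [ei] at hi
    rw [ej] at hj
    have hi' := neg_notMem_lineLabels hi
    have hj' := neg_notMem_lineLabels hj
    rw [neg_neg] at hi'
    intro a ha
    exact ⟨fun h => hj' (h ▸ ha), fun h => hi' (h ▸ ha)⟩
  rw [wordFillings, wordFillings, ← lineLabels_swap, hr, card_symFillings_image]
  · congr 1
    refine Finset.filter_congr fun P hP => ?_
    rw [mem_symFillings] at hP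
    constructor
    · intro h a b hab
      have h1 := hij (hP.mem _ _ hab)
      have h2 := hij (hP.mem_right hab)
      have h3 : ¬ (a = -((y.length : ℤ) + 2) ∧ b = (y.length : ℤ) + 1) := by
        rintro ⟨rfl, rfl⟩; exact h hab
      have h4 : ¬ (b = -((y.length : ℤ) + 2) ∧ a = (y.length : ℤ) + 1) := by
        rintro ⟨rfl, rfl⟩; exact h (hP.symm _ _ hab)
      have h5 := hP.cell _ _ hab
      simp only [LabelCell, swapLabel] at h5 ⊢
      split_ifs <;> omega
    · intro h hab
      have := h _ _ hab
      simp only [LabelCell, swapLabel] at this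
      split_ifs at this <;> omega
  · exact root_mem_lineLabels _
  · intro a ha b hb hab
    have h1 := hij ha
    have h2 := hij hb
    simp only [swapLabel]
    split_ifs <;> omega
  · intro a ha b hb hab
    have h1 := hij ha
    have h2 := hij hb
    simp only [LabelCell, swapLabel] at hab ⊢
    split_ifs at hab <;> omega

/-- The only cell lost is the diagonal one, which is not the root and so never carries a point. -/
theorem card_wordFillings_diag (x : List Bool) :
    (wordFillings (true :: x ++ [false])).card = (wordFillings (true :: x ++ [true])).card := by
  classical
  have hr : -((true :: x ++ [false]).length : ℤ) =
      diagLabel (-((true :: x ++ [true]).length : ℤ)) := by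
    simp only [List.length_cons, List.length_append, diagLabel, List.length_nil]
    push_cast
    split_ifs <;> omega
  have hone : ∀ {a}, a ∈ lineLabels (true :: x ++ [true]) → a ≠ 1 ∧ a ≠ 0 := by
    intro a ha
    have hi := stepLabel_mem (true :: x) true []
    simp only [stepLabel, List.length_nil, if_true] at hi
    constructor
    · rintro rfl
      exact neg_notMem_lineLabels ha (by simpa using hi)
    · rintro rfl
      have := (lineLabels_bounds ha).1
      simp at this
  rw [wordFillings, wordFillings, ← lineLabels_diag, hr, card_symFillings_image,
    Finset.filter_true_of_mem]
  · intro P hP a b hab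
    rw [mem_symFillings] at hP
    have h0 : (-1, -1) ∉ P := hP.diag_notMem (by
      simp only [List.length_cons, List.length_append, List.length_nil]
      push_cast
      omega)
    have h1 := hone (hP.mem _ _ hab)
    have h2 := hone (hP.mem_right hab)
    have h3 : ¬ (a = -1 ∧ b = -1) := by
      rintro ⟨rfl, rfl⟩; exact h0 hab
    have h5 := hP.cell _ _ hab
    have h6 : a ≠ -b := fun h => neg_notMem_lineLabels (hP.mem_right hab) (h ▸ hP.mem _ _ hab)
    simp only [LabelCell, diagLabel] at h5 ⊢
    split_ifs <;> omega
  · exact root_mem_lineLabels _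
  · intro a ha b hb hab
    have h1 := hone ha
    have h2 := hone hb
    simp only [diagLabel]
    split_ifs <;> omega
  · intro a ha b hb hab
    simp only [LabelCell, diagLabel] at hab ⊢
    split_ifs at hab <;> omega

theorem wordFillings_root_corner (y : List Bool) :
    (∀ P ∈ wordFillings (true :: false :: y),
      (-((y.length : ℤ) + 2), (y.length : ℤ) + 1) ∈ P) ∧
    (wordFillings (true :: false :: y)).card = (wordFillings (true :: y)).card := by
  have hj := stepLabel_mem [true] false y
  have h2 := card_symFillings_erase [] false y
  simp only [List.cons_append, List.nil_append] at hj h2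
  have ej : stepLabel false y.length = (y.length : ℤ) + 1 := by simp [stepLabel]
  have er : -((true :: false :: y).length : ℤ) = -((y.length : ℤ) + 2) := by
    simp only [List.length_cons]; push_cast; ring
  rw [ej] at hj h2
  have hr := root_mem_lineLabels (false :: y)
  have hle := fun a ha => root_le_lineLabels (w := true :: false :: y) (a := a) ha
  rw [← h2]
  unfold wordFillings
  rw [er] at hr hle ⊢
  refine card_symFillings_root_corner hj hr ?_ hle ?_ ?_ ?_ ?_ ?_
  all_goals first
    | (intro b hb; simp only [LabelCell]; omega)
    | (simp only [LabelCell]; omega)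
    | omega

theorem card_wordFillings_singleton : (wordFillings [true]).card = 1 := by
  rw [Finset.card_eq_one]
  refine ⟨{(-1, -1)}, ?_⟩
  ext P
  simp only [wordFillings, lineLabels, stepLabel, mem_symFillings, Finset.mem_singleton,
    List.length_cons, List.length_nil]
  constructor
  · intro h
    refine Finset.Subset.antisymm ?_ (by simpa using h.root)
    rintro ⟨a, b⟩ hab
    have h1 := h.mem _ _ hab
    have h2 := h.mem_right hab
    simp at h1 h2
    simp [h1, h2]
  · rintro rfl
    refine ⟨?_, ?_, ?_, ?_, ?_, ?_, ?_⟩ <;> simp [LabelCell]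

end Labels

/-! ### Summation over words: number of fillings and number of occupied corners -/

section Words

/-- The words of length `n` in two letters. -/
def words : ℕ → Finset (List Bool)
  | 0 => {[]}
  | n + 1 => (words n).image (List.cons true) ∪ (words n).image (List.cons false)

theorem mem_words {n : ℕ} {w : List Bool} : w ∈ words n ↔ w.length = n := by
  induction n generalizing w with
  | zero => simp [words]
  | succ n ih =>
    cases w with
    | nil => simp [words]
    | cons b w => cases b <;> simp [words, ih]

theorem sum_words_succ (n : ℕ) (f : List Bool → ℕ) :
    ∑ w ∈ words (n + 1), f w = ∑ w ∈ words n, (f (true :: w) + f (false :: w)) := by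
  rw [words, Finset.sum_union, Finset.sum_image, Finset.sum_image, Finset.sum_add_distrib]
  · exact fun a _ b _ h => List.cons_injective h
  · exact fun a _ b _ h => List.cons_injective h
  · rw [Finset.disjoint_left]
    intro w h1 h2
    obtain ⟨a, _, rfl⟩ := Finset.mem_image.1 h1
    simp at h2

theorem sum_words_add (m n : ℕ) (f : List Bool → ℕ) :
    ∑ w ∈ words (m + n), f w = ∑ x ∈ words m, ∑ y ∈ words n, f (x ++ y) := by
  induction m generalizing f with
  | zero => simp [words]
  | succ m ih =>
    rw [Nat.succ_add, sum_words_succ, sum_words_succ, ih]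
    simp only [Finset.sum_add_distrib, List.cons_append]

theorem sum_words_add_cons (m n : ℕ) (f : List Bool → ℕ) :
    ∑ w ∈ words (m + n + 1), f w =
      ∑ x ∈ words m, ∑ y ∈ words n, (f (x ++ true :: y) + f (x ++ false :: y)) := by
  rw [add_assoc, sum_words_add]
  simp only [sum_words_succ]

/-- A combinatorial form of the relations `DE = ED + D + E`, `⟨V|E = ⟨V|`, `D|W⟩ = E|W⟩`. -/
theorem sum_words_of_recurrence {M : List Bool → ℕ}
    (h1 : ∀ x y, M (x ++ true :: false :: y) =
      M (x ++ true :: y) + M (x ++ false :: y) + M (x ++ false :: true :: y))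
    (h2 : ∀ y, M (false :: y) = M y) (h3 : ∀ x, M (x ++ [false]) = M (x ++ [true])) (n : ℕ) :
    ∑ w ∈ words (n + 1), M w = 2 * (n + 1) * ∑ w ∈ words n, M w := by
  -- In operator form: D(D + E) = (D + E)D + (D + E).
  have step : ∀ k l, ∑ x ∈ words k, ∑ y ∈ words (l + 1), M (x ++ true :: y) =
      ∑ x ∈ words (k + 1), ∑ y ∈ words l, M (x ++ true :: y) +
        ∑ w ∈ words (k + l + 1), M w := by
    intro k l
    have e := sum_words_add_cons k 0 fun x => ∑ y ∈ words l, M (x ++ true :: y)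
    rw [add_zero] at e
    rw [e, sum_words_add_cons, ← Finset.sum_add_distrib]
    refine Finset.sum_congr rfl fun x _ => ?_
    rw [sum_words_succ]
    simp only [words, Finset.sum_singleton, List.append_assoc, List.cons_append, List.nil_append,
      Finset.sum_add_distrib, h1]
    ring
  -- Iterating: D(D + E)^l = (D + E)^l D + l (D + E)^l.
  have tele : ∀ l k, ∑ x ∈ words k, ∑ y ∈ words l, M (x ++ true :: y) =
      ∑ x ∈ words (k + l), M (x ++ [true]) + l * ∑ w ∈ words (k + l), M w := by
    intro l
    induction l with
    | zero => intro k; simp [words]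
    | succ l ih =>
      intro k
      rw [step, ih, show k + 1 + l = k + (l + 1) by ring, show k + l + 1 = k + (l + 1) by ring]
      ring
  have hB := tele n 0
  simp only [words, Finset.sum_singleton, List.nil_append, zero_add] at hB
  -- Words ending in D contribute half of the total, by `h3`; those starting with E contribute the
  -- previous total, by `h2`.
  have hA : ∑ w ∈ words (n + 1), M w = 2 * ∑ x ∈ words n, M (x ++ [true]) := by
    have := sum_words_add_cons n 0 M
    simp only [words, Finset.sum_singleton, h3] at this
    rw [words, this, Finset.mul_sum]
    exact Finset.sum_congr rfl fun _ _ => by ring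
  have hA' := sum_words_succ n M
  rw [Finset.sum_add_distrib, hB] at hA'
  simp only [h2] at hA'
  linarith

open Classical in
theorem card_wordFillings_corner (x y : List Bool) :
    (wordFillings (true :: x ++ true :: false :: y)).card =
      (wordFillings (true :: x ++ true :: y)).card + (wordFillings (true :: x ++ false :: y)).card +
        (wordFillings (true :: x ++ false :: true :: y)).card := by
  rw [← card_wordFillings_corner_mem, ← card_wordFillings_corner_notMem,
    Finset.card_filter_add_card_filter_not]

/-- The number of symmetric fillings with `n + 1` lines. -/
noncomputable def fillingCount (n : ℕ) : ℕ := ∑ w ∈ words n, (wordFillings (true :: w)).card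

theorem fillingCount_zero : fillingCount 0 = 1 := by
  simp [fillingCount, words, card_wordFillings_singleton]

theorem fillingCount_succ (n : ℕ) : fillingCount (n + 1) = 2 * (n + 1) * fillingCount n :=
  sum_words_of_recurrence (M := fun w => (wordFillings (true :: w)).card)
    card_wordFillings_corner (fun y => (wordFillings_root_corner y).2) card_wordFillings_diag n

theorem fillingCount_eq (n : ℕ) : fillingCount n = 2 ^ n * n ! := by
  induction n with
  | zero => simp [fillingCount_zero]
  | succ n ih =>
    rw [fillingCount_succ, ih, Nat.factorial_succ]
    ring

open Classical in
/-- The number of fillings of `w` in which the corner with labels `-(t + 2)` and `t + 1` exists and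
is occupied. -/
noncomputable def cornerCount (t : ℕ) (w : List Bool) : ℕ :=
  ((wordFillings w).filter fun P => (-((t : ℤ) + 2), (t : ℤ) + 1) ∈ P).card

/-- The opposite of a used label is unused, so one line of the corner is missing. -/
theorem cornerCount_eq_zero {t : ℕ} {w : List Bool}
    (h : -((t : ℤ) + 1) ∈ lineLabels w ∨ (t : ℤ) + 2 ∈ lineLabels w) : cornerCount t w = 0 := by
  rw [cornerCount, Finset.card_eq_zero, Finset.filter_eq_empty_iff]
  intro P hP hmem
  rw [wordFillings, mem_symFillings] at hP
  rcases h with h | h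
  · exact neg_notMem_lineLabels h (by simpa using hP.mem_right hmem)
  · exact neg_notMem_lineLabels h (hP.mem _ _ hmem)

/-- Only words with DE just before the last `t` letters contribute. An occupied corner there reduces
DE to D or to E, so all words with one letter less appear, once each. -/
theorem sum_cornerCount (t n : ℕ) (ht : t ≤ n) :
    ∑ w ∈ words (n + 1), cornerCount t (true :: w) = fillingCount n := by
  rcases Nat.lt_or_ge t n with h | h
  · obtain ⟨k, rfl⟩ := Nat.exists_eq_add_of_lt h
    rw [show t + k + 1 + 1 = k + (t + 1) + 1 by ring, sum_words_add_cons, fillingCount,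
      show t + k + 1 = k + t + 1 by ring, sum_words_add_cons]
    refine Finset.sum_congr rfl fun x _ => ?_
    rw [sum_words_succ]
    refine Finset.sum_congr rfl fun y hy => ?_
    rw [mem_words] at hy
    subst hy
    have hD : ∀ z, -((y.length : ℤ) + 1) ∈ lineLabels (z ++ true :: y) := fun z => by
      simpa [stepLabel] using stepLabel_mem z true y
    have hE : (y.length : ℤ) + 2 ∈ lineLabels (true :: x ++ false :: false :: y) := by
      have := stepLabel_mem (true :: x) false (false :: y)
      simp only [stepLabel, List.length_cons] at this
      push_cast at this
      rwa [add_assoc] at this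
    have z1 : cornerCount y.length (true :: x ++ true :: true :: y) = 0 :=
      cornerCount_eq_zero (Or.inl (by simpa using hD (true :: x ++ [true])))
    have z2 : cornerCount y.length (true :: x ++ false :: true :: y) = 0 :=
      cornerCount_eq_zero (Or.inl (by simpa using hD (true :: x ++ [false])))
    have z3 : cornerCount y.length (true :: x ++ false :: false :: y) = 0 :=
      cornerCount_eq_zero (Or.inr hE)
    have z4 := card_wordFillings_corner_mem x y
    simp only [List.cons_append] at z1 z2 z3 z4
    rw [z1, z2, z3]
    simp only [cornerCount, zero_add, add_zero]
    rw [← z4]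
  -- Here the D of the corner is the initial step of the border, so the corner is in the first row
  -- and always occupied.
  · obtain rfl := le_antisymm ht h
    rw [sum_words_succ, fillingCount]
    refine Finset.sum_congr rfl fun y hy => ?_
    rw [mem_words] at hy
    subst hy
    have z1 : cornerCount y.length ([true] ++ true :: y) = 0 :=
      cornerCount_eq_zero (Or.inl (by simpa [stepLabel] using stepLabel_mem [true] true y))
    simp only [List.cons_append, List.nil_append] at z1
    obtain ⟨h1, h2⟩ := wordFillings_root_corner y
    rw [z1, zero_add, cornerCount, Finset.filter_true_of_mem h1, h2]

/-- Labels with sum `-1` are those of consecutive steps DE, up to reflection, which exchanges the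
two halves. Since `t + 2` is at most the number of lines, `t < n`. -/
theorem card_points_add_eq_neg_one {n : ℕ} {w : List Bool} (hw : w.length = n + 1)
    {P : Finset (ℤ × ℤ)} (hP : P ∈ wordFillings w) :
    (P.filter fun p => p.1 + p.2 = -1).card =
      2 * ((Finset.range n).filter fun t : ℕ => (-((t : ℤ) + 2), (t : ℤ) + 1) ∈ P).card := by
  classical
  rw [wordFillings, mem_symFillings] at hP
  set R := (Finset.range n).filter fun t : ℕ => (-((t : ℤ) + 2), (t : ℤ) + 1) ∈ P with hR
  have hsplit : (P.filter fun p => p.1 + p.2 = -1) =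
      R.image (fun t : ℕ => (-((t : ℤ) + 2), (t : ℤ) + 1)) ∪
        R.image (fun t : ℕ => ((t : ℤ) + 1, -((t : ℤ) + 2))) := by
    ext ⟨a, b⟩
    simp only [Finset.mem_filter, Finset.mem_union, Finset.mem_image, hR, Finset.mem_range,
      Prod.mk.injEq]
    constructor
    · rintro ⟨hab, hs⟩
      have h1 := lineLabels_bounds (hP.mem _ _ hab)
      have h2 := lineLabels_bounds (hP.mem_right hab)
      rw [hw, le_abs, abs_le] at h1 h2
      push_cast at h1 h2
      rcases lt_or_ge a 0 with ha | ha
      · left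
        have e1 : -(((b - 1).toNat : ℤ) + 2) = a := by omega
        have e2 : ((b - 1).toNat : ℤ) + 1 = b := by omega
        exact ⟨(b - 1).toNat, ⟨by omega, by rw [e1, e2]; exact hab⟩, e1, e2⟩
      · right
        have e1 : -(((a - 1).toNat : ℤ) + 2) = b := by omega
        have e2 : ((a - 1).toNat : ℤ) + 1 = a := by omega
        exact ⟨(a - 1).toNat, ⟨by omega, by rw [e1, e2]; exact hP.symm _ _ hab⟩, e2, e1⟩
    · rintro (⟨t, ⟨_, h⟩, rfl, rfl⟩ | ⟨t, ⟨_, h⟩, rfl, rfl⟩)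
      · exact ⟨h, by ring⟩
      · exact ⟨hP.symm _ _ h, by ring⟩
  rw [hsplit, Finset.card_union_of_disjoint, Finset.card_image_of_injective,
    Finset.card_image_of_injective]
  · ring
  · intro a b h
    simpa using h
  · intro a b h
    simpa using h
  · rw [Finset.disjoint_left]
    intro p h1 h2
    obtain ⟨a, _, rfl⟩ := Finset.mem_image.1 h1
    obtain ⟨b, _, h⟩ := Finset.mem_image.1 h2
    simp only [Prod.mk.injEq] at h
    omega

/-- The total number of occupied off-diagonal corners. -/
theorem sum_card_points_add_eq_neg_one (n : ℕ) :
    ∑ w ∈ words (n + 1), ∑ P ∈ wordFillings (true :: w), (P.filter fun p => p.1 + p.2 = -1).card =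
      fillingCount (n + 1) := by
  classical
  have h : ∀ w ∈ words (n + 1), ∑ P ∈ wordFillings (true :: w),
      (P.filter fun p => p.1 + p.2 = -1).card =
        2 * ∑ t ∈ Finset.range (n + 1), cornerCount t (true :: w) := by
    intro w hw
    rw [mem_words] at hw
    rw [Finset.sum_congr rfl fun P hP =>
      card_points_add_eq_neg_one (n := n + 1) (w := true :: w) (by simp [hw]) hP, ← Finset.mul_sum]
    simp only [cornerCount, Finset.card_filter]
    rw [Finset.sum_comm]
  -- There are `n + 1` distances with equal contributions, and the factor `2 * (n + 1)` is the one
  -- in `fillingCount_succ`.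
  rw [Finset.sum_congr rfl h, ← Finset.mul_sum, Finset.sum_comm,
    Finset.sum_congr rfl fun t ht => sum_cornerCount t n (Nat.lt_succ_iff.1 (Finset.mem_range.1 ht)),
    fillingCount_succ]
  simp
  ring

end Words

/-! ### Which sets of integers are label sets of words -/

section LabelSets

theorem card_lineLabels (w : List Bool) : (lineLabels w).card = w.length := by
  induction w with
  | nil => rfl
  | cons b w ih =>
    rw [lineLabels, Finset.card_insert_of_notMem (stepLabel_notMem le_rfl), ih, List.length_cons]

theorem abs_stepLabel (b : Bool) (t : ℕ) : |stepLabel b t| = (t : ℤ) + 1 := by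
  cases b
  · simp only [stepLabel, Bool.false_eq_true, if_false]
    exact abs_of_nonneg (by omega)
  · simp only [stepLabel, if_true, abs_neg]
    exact abs_of_nonneg (by omega)

theorem card_lineLabels_abs_le (w : List Bool) (k : ℕ) (hk : k ≤ w.length) :
    ((lineLabels w).filter fun a : ℤ => |a| ≤ k).card = k := by
  induction w with
  | nil => simpa [lineLabels, eq_comm] using hk
  | cons b w ih =>
    rcases Nat.lt_or_ge w.length k with h | h
    · rw [Finset.filter_true_of_mem, card_lineLabels]
      · exact le_antisymm h hk
      · intro a ha
        have := (lineLabels_bounds ha).2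
        exact this.trans (by exact_mod_cast h)
    · rw [lineLabels, Finset.filter_insert, if_neg, ih h]
      rw [abs_stepLabel]
      omega

theorem lineLabels_injective {w w' : List Bool} (hl : w.length = w'.length)
    (h : lineLabels w = lineLabels w') : w = w' := by
  induction w generalizing w' with
  | nil => exact (List.length_eq_zero_iff.1 hl.symm).symm
  | cons b w ih =>
    cases w' with
    | nil => simp at hl
    | cons b' w' =>
      simp only [List.length_cons, add_left_inj] at hl
      have hb : stepLabel b w.length = stepLabel b' w'.length := by
        have h1 : stepLabel b w.length ∈ lineLabels (b' :: w') := h ▸ Finset.mem_insert_self _ _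
        exact (Finset.mem_insert.1 h1).resolve_right (stepLabel_notMem hl.ge)
      have hbb : b = b' := by
        rw [hl] at hb
        cases b <;> cases b' <;> simp [stepLabel] at hb ⊢ <;> omega
      subst hbb
      congr 1
      refine ih hl ?_
      have h2 := congrArg (fun s => s.erase (stepLabel b w.length)) h
      simp only [lineLabels] at h2
      rwa [Finset.erase_insert (stepLabel_notMem le_rfl), hl,
        Finset.erase_insert (stepLabel_notMem le_rfl)] at h2

/-- Such a set contains exactly one of `k` and `-k` for each `k` from `1` to `m`. The element of
largest absolute value gives the first step. -/
theorem exists_lineLabels_eq (m : ℕ) (A : Finset ℤ) (hA : A.card = m)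
    (hb : ∀ a ∈ A, 1 ≤ |a| ∧ |a| ≤ m) (hneg : ∀ a ∈ A, -a ∉ A) :
    ∃ w : List Bool, w.length = m ∧ lineLabels w = A := by
  induction m generalizing A with
  | zero => exact ⟨[], rfl, (Finset.card_eq_zero.1 hA).symm⟩
  | succ m ih =>
    have hinj : Set.InjOn (fun a : ℤ => |a|) A := by
      intro a ha b hb h
      rcases abs_eq_abs.1 h with h | h
      · exact h
      · exact absurd (h ▸ ha) (hneg b hb)
    have himg : A.image (fun a => |a|) = Finset.Icc 1 ((m : ℤ) + 1) := by
      refine Finset.eq_of_subset_of_card_le ?_ ?_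
      · intro x hx
        obtain ⟨a, ha, rfl⟩ := Finset.mem_image.1 hx
        have := hb a ha
        push_cast at this
        exact Finset.mem_Icc.2 this
      · rw [Finset.card_image_of_injOn hinj, hA]
        simp
    have hmem : (m : ℤ) + 1 ∈ A.image (fun a => |a|) := by
      rw [himg]
      exact Finset.mem_Icc.2 (by omega)
    obtain ⟨a, ha, habs⟩ := Finset.mem_image.1 hmem
    obtain ⟨w, hw, hwA⟩ := ih (A.erase a) (by rw [Finset.card_erase_of_mem ha, hA]; rfl)
      (by
        intro x hx
        rw [Finset.mem_erase] at hx
        have h1 := hb x hx.2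
        have h2 : |x| ≠ |a| := fun h => hx.1 (hinj hx.2 ha h)
        push_cast at h1
        omega)
      (fun x hx h => hneg x (Finset.mem_of_mem_erase hx) (Finset.mem_of_mem_erase h))
    refine ⟨decide (a < 0) :: w, by simp [hw], ?_⟩
    have hst : stepLabel (decide (a < 0)) w.length = a := by
      simp only [stepLabel, decide_eq_true_eq, hw]
      split_ifs with h0
      · rw [abs_of_neg h0] at habs
        omega
      · rw [abs_of_nonneg (not_lt.1 h0)] at habs
        omega
    rw [lineLabels, hst, hwA, Finset.insert_erase ha]

theorem exists_enumeration (m : ℕ) (A : Finset ℤ) (hA : A.card = m) :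
    ∃ e : ℕ → ℤ, StrictMonoOn e (Finset.range m : Finset ℕ) ∧ (Finset.range m).image e = A := by
  refine ⟨fun i => if h : i < m then A.orderEmbOfFin hA ⟨i, h⟩ else 0, ?_, ?_⟩
  · intro i hi j hj hij
    simp only [Finset.coe_range, Set.mem_Iio] at hi hj
    simp only [hi, hj, dif_pos, OrderEmbedding.lt_iff_lt]
    exact hij
  · ext a
    rw [Finset.mem_image]
    constructor
    · rintro ⟨i, hi, rfl⟩
      rw [Finset.mem_range] at hi
      simp [hi]
    · intro ha
      have : a ∈ Set.range (A.orderEmbOfFin hA) := by simpa using ha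
      obtain ⟨i, rfl⟩ := this
      exact ⟨i, by simp, by simp⟩

end LabelSets

/-! ### Line labels read off a symmetric Young diagram -/

namespace YoungDiagram

/-- The label of the `i`th line of a symmetric diagram. -/
def lineLabel (μ : YoungDiagram) (i : ℕ) : ℤ :=
  if i < μ.rowLen i then (i : ℤ) - μ.rowLen i else (i : ℤ) + 1 - μ.rowLen i

variable {μ : YoungDiagram}

theorem lt_rowLen_comm (hμ : μ.transpose = μ) (i j : ℕ) : j < μ.rowLen i ↔ i < μ.rowLen j := by
  rw [← mem_iff_lt_rowLen, ← mem_iff_lt_rowLen]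
  conv_lhs => rw [← hμ]
  rw [mem_transpose]
  rfl

theorem lineLabel_add_neg (hμ : μ.transpose = μ) (i j : ℕ) :
    μ.lineLabel i + μ.lineLabel j < 0 ↔ (i, j) ∈ μ := by
  have h := lt_rowLen_comm hμ i j
  rw [mem_iff_lt_rowLen]
  simp only [lineLabel]
  split_ifs <;> omega

theorem lineLabel_add_ne_zero (hμ : μ.transpose = μ) (i j : ℕ) :
    μ.lineLabel i + μ.lineLabel j ≠ 0 := by
  have h := lt_rowLen_comm hμ i j
  simp only [lineLabel]
  split_ifs <;> omega

theorem lineLabel_strictMono : StrictMono μ.lineLabel := by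
  intro i j hij
  have h := μ.rowLen_anti i j hij.le
  simp only [lineLabel]
  split_ifs <;> omega

/-- On the diagonal the sum is even, so a diagonal corner escapes this criterion. -/
theorem lineLabel_add_eq_neg_one (hμ : μ.transpose = μ) {i j : ℕ} (hij : i ≠ j)
    (h : (i, j) ∈ μ) :
    μ.lineLabel i + μ.lineLabel j = -1 ↔ (i + 1, j) ∉ μ ∧ (i, j + 1) ∉ μ := by
  have h1 := lt_rowLen_comm hμ i j
  have h2 := lt_rowLen_comm hμ (i + 1) j
  rw [mem_iff_lt_rowLen] at h ⊢
  rw [mem_iff_lt_rowLen]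
  simp only [lineLabel]
  split_ifs <;> omega

theorem lineLabel_bounds {m i : ℕ} (hm : μ.rowLen 0 = m) (hi : i < m) :
    1 ≤ |μ.lineLabel i| ∧ |μ.lineLabel i| ≤ m := by
  have h := μ.rowLen_anti 0 i (Nat.zero_le i)
  rw [le_abs, abs_le]
  simp only [lineLabel]
  split_ifs <;> omega

theorem mem_range_of_mem (hμ : μ.transpose = μ) {i j : ℕ} (h : (i, j) ∈ μ) :
    i < μ.rowLen 0 ∧ j < μ.rowLen 0 := by
  have h1 := lt_rowLen_comm hμ i 0
  have h2 := μ.rowLen_anti 0 i (Nat.zero_le i)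
  rw [mem_iff_lt_rowLen] at h
  omega

/-- As each distance occurs once, exactly `|e i|` lines are at distance at most `|e i|`. They form
an interval bounded by `i` and `μ.rowLen i`, whose length is the absolute value of `μ.lineLabel i`.
-/
theorem lineLabel_eq_of_enumeration {m : ℕ} {w : List Bool} {e : ℕ → ℤ}
    (he : StrictMonoOn e (Finset.range m : Finset ℕ)) (hew : (Finset.range m).image e = lineLabels w)
    (hμ : ∀ i j, (i, j) ∈ μ ↔ i < m ∧ j < m ∧ e i + e j < 0) {i : ℕ} (hi : i < m) :
    μ.lineLabel i = e i := by
  have hmem : ∀ j < m, e j ∈ lineLabels w := fun j hj =>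
    hew ▸ Finset.mem_image_of_mem e (Finset.mem_range.2 hj)
  have hle : μ.rowLen i ≤ m := by
    by_contra hlt
    have := (hμ i m).1 (mem_iff_lt_rowLen.2 (not_le.1 hlt))
    omega
  have hcell : ∀ j < m, (j < μ.rowLen i ↔ e i + e j < 0) := by
    intro j hj
    rw [← mem_iff_lt_rowLen, hμ]
    simp [hi, hj]
  have hmono : ∀ j < m, ∀ k < m, (e j ≤ e k ↔ j ≤ k) := fun j hj k hk =>
    he.le_iff_le (by simpa using hj) (by simpa using hk)
  have hb := lineLabels_bounds (hmem i hi)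
  have hcard : ((Finset.range m).filter fun j => |e j| ≤ (e i).natAbs).card = (e i).natAbs := by
    have h1 := card_lineLabels_abs_le w (e i).natAbs (by zify; exact hb.2)
    rw [← hew, Finset.filter_image, Finset.card_image_of_injOn] at h1
    · exact h1
    · exact he.injOn.mono (by intro x hx; simp at hx ⊢; exact hx.1)
  have hne : ∀ j < m, e j ≠ -e i := fun j hj h =>
    neg_notMem_lineLabels (hmem i hi) (h ▸ hmem j hj)
  have hii := hcell i hi
  simp only [lineLabel]
  split_ifs with h
  · have hset : ((Finset.range m).filter fun j => |e j| ≤ (e i).natAbs) =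
        Finset.Ico i (μ.rowLen i) := by
      ext j
      simp only [Finset.mem_filter, Finset.mem_range, Finset.mem_Ico, abs_le]
      constructor
      · rintro ⟨hj, h1⟩
        have h2 := hmono i hi j hj
        have h3 := hcell j hj
        have h4 := hne j hj
        omega
      · rintro ⟨h1, h5⟩
        have hj : j < m := by omega
        have h2 := hmono i hi j hj
        have h3 := hcell j hj
        omega
    rw [hset, Nat.card_Ico] at hcard
    omega
  · have hset : ((Finset.range m).filter fun j => |e j| ≤ (e i).natAbs) =
        Finset.Ico (μ.rowLen i) (i + 1) := by
      ext j
      simp only [Finset.mem_filter, Finset.mem_range, Finset.mem_Ico, abs_le]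
      constructor
      · rintro ⟨hj, h1⟩
        have h2 := hmono j hj i hi
        have h3 := hcell j hj
        omega
      · rintro ⟨h1, h5⟩
        have hj : j < m := by omega
        have h2 := hmono j hj i hi
        have h3 := hcell j hj
        omega
    rw [hset, Nat.card_Ico] at hcard
    rw [le_abs] at hb
    omega

end YoungDiagram

/-! ### Bijection between symmetric tableaux and fillings of words, and conclusion -/

namespace TreeLikeTableau

theorem IsSymmetric.isSymFilling {T : TreeLikeTableau} (hT : T.IsSymmetric) :
    IsSymFilling 0 (Finset.range (T.shape.rowLen 0)) (fun i j => (i, j) ∈ T.shape) T.points := by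
  have hcell : ∀ i j, (i, j) ∈ T.points → (i, j) ∈ T.shape := fun i j h => T.points_subset h
  refine ⟨?_, hcell, fun i j h => (hT.2 i j).1 h, T.root_mem, fun _ _ => Nat.zero_le _,
    T.parent, ?_⟩
  · intro i j h
    exact Finset.mem_range.2 (YoungDiagram.mem_range_of_mem hT.1 (hcell i j h)).1
  · intro i hi
    rw [Finset.mem_range, YoungDiagram.lt_rowLen_comm hT.1, ← YoungDiagram.mem_iff_lt_rowLen] at hi
    exact T.row_nonempty i 0 hi

theorem IsSymmetric.rowLen_eq {T : TreeLikeTableau} {n : ℕ} (hT : T.IsSymmetric)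
    (hs : T.size = 2 * n + 1) : T.shape.rowLen 0 = n + 1 := by
  have := hT.isSymFilling.card_add_one
  rw [Finset.card_range] at this
  simp only [size] at hs
  omega

/-- The points of a symmetric tree-like tableau, with rows and columns replaced by line labels. -/
def labelledPoints (T : TreeLikeTableau) : Finset (ℤ × ℤ) :=
  T.points.image (Prod.map T.shape.lineLabel T.shape.lineLabel)

/-- All fillings with `n + 1` lines. -/
noncomputable def allFillings (n : ℕ) : Finset (Finset (ℤ × ℤ)) :=
  (words n).biUnion fun w => wordFillings (true :: w)

theorem IsSymmetric.labelledPoints_isSymFilling {T : TreeLikeTableau} (hT : T.IsSymmetric) :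
    IsSymFilling (-(T.shape.rowLen 0 : ℤ))
      ((Finset.range (T.shape.rowLen 0)).image T.shape.lineLabel) LabelCell T.labelledPoints := by
  have h := hT.isSymFilling
  have h0 : 0 < T.shape.rowLen 0 := Finset.mem_range.1 (h.mem _ _ h.root)
  have := h.image (C' := LabelCell) (T.shape.lineLabel_strictMono.strictMonoOn _)
    fun i j hij => (YoungDiagram.lineLabel_add_neg hT.1 i j).2 (h.cell i j hij)
  rwa [show T.shape.lineLabel 0 = -(T.shape.rowLen 0 : ℤ) by
    simp [YoungDiagram.lineLabel, h0]] at this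

theorem IsSymmetric.labelledPoints_mem {T : TreeLikeTableau} {n : ℕ} (hT : T.IsSymmetric)
    (hs : T.size = 2 * n + 1) : T.labelledPoints ∈ allFillings n := by
  have hm := hT.rowLen_eq hs
  have h := hT.labelledPoints_isSymFilling
  obtain ⟨w, hw, hwA⟩ := exists_lineLabels_eq (n + 1)
    ((Finset.range (T.shape.rowLen 0)).image T.shape.lineLabel)
    (by rw [Finset.card_image_of_injective _ T.shape.lineLabel_strictMono.injective,
          Finset.card_range, hm])
    (by
      intro a ha
      obtain ⟨i, hi, rfl⟩ := Finset.mem_image.1 ha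
      exact YoungDiagram.lineLabel_bounds hm (hm ▸ Finset.mem_range.1 hi))
    (by
      intro a ha ha'
      obtain ⟨i, _, rfl⟩ := Finset.mem_image.1 ha
      obtain ⟨j, _, hj⟩ := Finset.mem_image.1 ha'
      exact YoungDiagram.lineLabel_add_ne_zero hT.1 i j (by omega))
  rw [← hwA, hm] at h
  cases w with
  | nil => simp at hw
  | cons b w =>
    simp only [List.length_cons, add_left_inj] at hw
    -- The root carries the label `-(n + 1)`, so the first step cannot have the opposite label.
    have hb : b = true := by
      cases b with
      | true => rfl
      | false =>
        have h1 := h.mem _ _ h.root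
        have h2 := stepLabel_mem [] false w
        rw [List.nil_append] at h2
        refine absurd h1 ?_
        have h3 := neg_notMem_lineLabels h2
        simpa [stepLabel, hw] using h3
    subst hb
    refine Finset.mem_biUnion.2 ⟨w, mem_words.2 hw, ?_⟩
    rw [wordFillings, mem_symFillings, List.length_cons, hw]
    exact h

/-- Every line has a point, so the points determine the label set; labels increase along the lines,
so the set determines each label, and then the diagram. -/
theorem labelledPoints_injOn (n : ℕ) : Set.InjOn labelledPoints (symTableaux (2 * n + 1)) := by
  rintro T ⟨hs, hT⟩ T' ⟨hs', hT'⟩ hTT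
  have hm := hT.rowLen_eq hs
  have hm' := hT'.rowLen_eq hs'
  have h := hT.labelledPoints_isSymFilling
  have h' := hT'.labelledPoints_isSymFilling
  rw [hm] at h
  rw [hm', ← hTT] at h'
  have hset : (Finset.range (n + 1)).image T.shape.lineLabel =
      (Finset.range (n + 1)).image T'.shape.lineLabel := by
    ext a
    constructor
    · intro ha
      obtain ⟨b, hb⟩ := h.line a ha
      exact h'.mem _ _ hb
    · intro ha
      obtain ⟨b, hb⟩ := h'.line a ha
      exact h.mem _ _ hb
  have hfun : (fun i : Fin (n + 1) => T.shape.lineLabel i) =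
      fun i : Fin (n + 1) => T'.shape.lineLabel i := by
    refine (StrictMono.range_inj
      (T.shape.lineLabel_strictMono.comp Fin.val_strictMono)
      (T'.shape.lineLabel_strictMono.comp Fin.val_strictMono)).1 ?_
    ext a
    have := Finset.ext_iff.1 hset a
    simp only [Finset.mem_image, Finset.mem_range] at this
    simp only [Set.mem_range, Fin.exists_iff]
    simpa using this
  have hlab : ∀ i < n + 1, T.shape.lineLabel i = T'.shape.lineLabel i := fun i hi =>
    congrFun hfun ⟨i, hi⟩
  have hshape : T.shape = T'.shape := by
    refine YoungDiagram.ext ?_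
    ext ⟨i, j⟩
    rw [YoungDiagram.mem_cells, YoungDiagram.mem_cells]
    constructor
    · intro hc
      have hr := YoungDiagram.mem_range_of_mem hT.1 hc
      rw [hm] at hr
      rw [← YoungDiagram.lineLabel_add_neg hT.1, hlab i hr.1, hlab j hr.2] at hc
      exact (YoungDiagram.lineLabel_add_neg hT'.1 i j).1 hc
    · intro hc
      have hr := YoungDiagram.mem_range_of_mem hT'.1 hc
      rw [hm'] at hr
      rw [← YoungDiagram.lineLabel_add_neg hT'.1, ← hlab i hr.1, ← hlab j hr.2] at hc
      exact (YoungDiagram.lineLabel_add_neg hT.1 i j).1 hc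
  refine TreeLikeTableau.ext hshape ?_
  have hinj := (T.shape.lineLabel_strictMono.injective.prodMap
    T.shape.lineLabel_strictMono.injective)
  simp only [labelledPoints, ← hshape] at hTT
  exact Finset.image_injective hinj hTT

/-- The tree-like tableau with a given symmetric filling. -/
theorem exists_of_isSymFilling {m : ℕ} {μ : YoungDiagram} {P : Finset (ℕ × ℕ)}
    (hμ : ∀ i j, (i, j) ∈ μ → i < m ∧ j < m) (hsym : μ.transpose = μ)
    (h : IsSymFilling 0 (Finset.range m) (fun i j => (i, j) ∈ μ) P) :
    ∃ T : TreeLikeTableau, T.shape = μ ∧ T.points = P ∧ T.IsSymmetric := by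
  refine ⟨⟨μ, P, fun p hp => h.cell p.1 p.2 hp, h.root, h.parent,
    fun i j hij => h.line i (Finset.mem_range.2 (hμ i j hij).1), ?_⟩, rfl, rfl, hsym,
    fun i j => ⟨h.symm i j, h.symm j i⟩⟩
  intro i j hij
  obtain ⟨b, hb⟩ := h.line j (Finset.mem_range.2 (hμ i j hij).2)
  exact ⟨b, h.symm _ _ hb⟩

theorem exists_diagram {m : ℕ} {e : ℕ → ℤ} (he : StrictMonoOn e (Finset.range m : Finset ℕ)) :
    ∃ μ : YoungDiagram, (∀ i j, (i, j) ∈ μ ↔ i < m ∧ j < m ∧ e i + e j < 0) ∧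
      μ.transpose = μ := by
  have hmem : ∀ i j, (i, j) ∈ ((Finset.range m ×ˢ Finset.range m).filter fun p =>
      e p.1 + e p.2 < 0) ↔ i < m ∧ j < m ∧ e i + e j < 0 := by
    intro i j
    simp [and_assoc]
  have hlow : IsLowerSet (((Finset.range m ×ˢ Finset.range m).filter fun p =>
      e p.1 + e p.2 < 0 : Finset (ℕ × ℕ)) : Set (ℕ × ℕ)) := by
    rintro ⟨i, j⟩ ⟨i', j'⟩ ⟨h1, h2⟩ h
    rw [Finset.mem_coe, hmem] at h ⊢
    simp only at h1 h2
    have hi : i' < m := by omega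
    have hj : j' < m := by omega
    have h3 := he.monotoneOn (by simpa using hi) (by simpa using h.1) h1
    have h4 := he.monotoneOn (by simpa using hj) (by simpa using h.2.1) h2
    exact ⟨hi, hj, by linarith [h.2.2]⟩
  refine ⟨⟨_, hlow⟩, fun i j => hmem i j, ?_⟩
  refine YoungDiagram.ext ?_
  ext ⟨i, j⟩
  rw [YoungDiagram.mem_cells, YoungDiagram.mem_transpose]
  change (j, i) ∈ Finset.filter _ _ ↔ (i, j) ∈ Finset.filter _ _
  rw [hmem, hmem, add_comm (e i)]
  tauto

/-- The increasing enumeration of the labels numbers the lines, and the pairs with negative sum form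
a symmetric diagram whose own labels are the given ones. -/
theorem labelledPoints_surjOn (n : ℕ) :
    Set.SurjOn labelledPoints (symTableaux (2 * n + 1)) (allFillings n) := by
  intro P hP
  rw [Finset.mem_coe, allFillings, Finset.mem_biUnion] at hP
  obtain ⟨w', hw', hP⟩ := hP
  rw [mem_words] at hw'
  obtain ⟨w, hw, rfl⟩ : ∃ w, w.length = n + 1 ∧ true :: w' = w := ⟨_, by simp [hw'], rfl⟩
  generalize true :: w' = w at hP hw
  rw [wordFillings, mem_symFillings] at hP
  obtain ⟨e, he, hew⟩ := exists_enumeration (n + 1) (lineLabels w) (by rw [card_lineLabels, hw])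
  obtain ⟨g, hg, hge⟩ := exists_strictMonoOn_leftInverse he ⟨0, by simp⟩
  rw [hew] at hg
  have heg : ∀ a ∈ lineLabels w, e (g a) = a := by
    intro a ha
    rw [← hew] at ha
    obtain ⟨i, hi, rfl⟩ := Finset.mem_image.1 ha
    rw [hge i hi]
  have hgr : (lineLabels w).image g = Finset.range (n + 1) := by
    rw [← hew, Finset.image_image]
    exact (Finset.image_congr (g := id) hge).trans Finset.image_id
  have hgm : ∀ a ∈ lineLabels w, g a < n + 1 := fun a ha =>
    Finset.mem_range.1 (hgr ▸ Finset.mem_image_of_mem g ha)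
  obtain ⟨μ, hμ, hsym⟩ := exists_diagram he
  have hfill := hP.image (C' := fun i j => (i, j) ∈ μ) hg fun a b hab => by
    have ha := hP.mem _ _ hab
    have hb := hP.mem_right hab
    rw [hμ, heg a ha, heg b hb]
    exact ⟨hgm a ha, hgm b hb, hP.cell _ _ hab⟩
  have hroot : g (-(w.length : ℤ)) = 0 := by
    rw [hgr] at hfill
    exact Nat.le_zero.1 (hfill.root_le 0 (by simp))
  rw [hgr, hroot] at hfill
  obtain ⟨T, hTμ, hTP, hT⟩ := exists_of_isSymFilling (m := n + 1)
    (fun i j h => ⟨((hμ i j).1 h).1, ((hμ i j).1 h).2.1⟩) hsym hfill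
  refine ⟨T, ⟨?_, hT⟩, ?_⟩
  · have := hfill.card_add_one
    rw [Finset.card_range, ← hTP] at this
    simp only [size]
    omega
  · rw [labelledPoints, hTμ, hTP, Finset.image_image]
    refine (Finset.image_congr (g := id) ?_).trans Finset.image_id
    rintro ⟨a, b⟩ hab
    have ha := hP.mem _ _ hab
    have hb := hP.mem_right hab
    have hlab := fun i (hi : i < n + 1) =>
      YoungDiagram.lineLabel_eq_of_enumeration he hew hμ hi
    simp [hlab _ (hgm a ha), hlab _ (hgm b hb), heg a ha, heg b hb]

theorem labelledPoints_bijOn (n : ℕ) :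
    Set.BijOn labelledPoints (symTableaux (2 * n + 1)) (allFillings n) :=
  ⟨fun _ hT => hT.2.labelledPoints_mem hT.1, labelledPoints_injOn n, labelledPoints_surjOn n⟩

/-- A filling uses every label of its word, so different words have no filling in common. -/
theorem sum_allFillings (n : ℕ) (f : Finset (ℤ × ℤ) → ℕ) :
    ∑ P ∈ allFillings n, f P = ∑ w ∈ words n, ∑ P ∈ wordFillings (true :: w), f P := by
  refine Finset.sum_biUnion ?_
  intro w hw w' hw' hne
  rw [Finset.mem_coe, mem_words] at hw hw'
  refine Finset.disjoint_left.2 fun P hP hP' => hne ?_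
  simp only [wordFillings, mem_symFillings] at hP hP'
  have : lineLabels (true :: w) = lineLabels (true :: w') := by
    ext a
    constructor
    · intro ha
      obtain ⟨b, hb⟩ := hP.line a ha
      exact hP'.mem _ _ hb
    · intro ha
      obtain ⟨b, hb⟩ := hP'.line a ha
      exact hP.mem _ _ hb
  exact (List.cons.inj (lineLabels_injective (by simp [hw, hw']) this)).2

theorem card_allFillings (n : ℕ) : (allFillings n).card = 2 ^ n * n ! := by
  rw [Finset.card_eq_sum_ones, sum_allFillings, ← fillingCount_eq, fillingCount]
  simp

theorem finite_symTableaux (n : ℕ) : (symTableaux (2 * n + 1)).Finite :=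
  (labelledPoints_bijOn n).finite_iff_finite.2 (Finset.finite_toSet _)

theorem ncard_symTableaux (n : ℕ) : (symTableaux (2 * n + 1)).ncard = 2 ^ n * n ! := by
  rw [← card_allFillings, ← Set.ncard_coe_finset, ← (labelledPoints_bijOn n).image_eq,
    (labelledPoints_injOn n).ncard_image]

/-- With at least two lines the root is not a corner, and no other diagonal cell is occupied, so all
occupied corners are off the diagonal. -/
theorem oc_eq_card {T : TreeLikeTableau} {n : ℕ} (hT : T ∈ symTableaux (2 * (n + 1) + 1)) :
    T.oc = (T.labelledPoints.filter fun p => p.1 + p.2 = -1).card := by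
  obtain ⟨hs, hT⟩ := hT
  have hm := hT.rowLen_eq hs
  have hfill := hT.isSymFilling
  have hinj := (T.shape.lineLabel_strictMono.injective.prodMap
    T.shape.lineLabel_strictMono.injective)
  rw [labelledPoints, Finset.filter_image, Finset.card_image_of_injective _ hinj, oc]
  congr 1
  ext ⟨i, j⟩
  simp only [corners, Finset.mem_filter, Prod.map_apply, YoungDiagram.mem_cells]
  rw [and_comm]
  refine and_congr_right fun hp => ?_
  have hc := hfill.cell i j hp
  simp only [hc, true_and]
  by_cases hij : i = j
  · subst hij
    have hi : i = 0 := by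
      by_contra hi
      exact hfill.diag_notMem hi hp
    subst hi
    have h1 : (0, 1) ∈ T.shape := YoungDiagram.mem_iff_lt_rowLen.2 (by omega)
    simp only [zero_add, h1, not_true, and_false, false_iff]
    omega
  · exact (YoungDiagram.lineLabel_add_eq_neg_one hT.1 hij hc).symm

theorem oc_of_mem_symTableaux_one {T : TreeLikeTableau} (hT : T ∈ symTableaux 1) : T.oc = 1 := by
  obtain ⟨hs, hT⟩ := hT
  have hm : T.shape.rowLen 0 = 1 := hT.rowLen_eq (n := 0) hs
  have hmem : ∀ i j, (i, j) ∈ T.shape → i = 0 ∧ j = 0 := fun i j h => by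
    have := YoungDiagram.mem_range_of_mem hT.1 h
    omega
  rw [oc, Finset.card_eq_one]
  refine ⟨(0, 0), ?_⟩
  ext ⟨i, j⟩
  simp only [corners, Finset.mem_filter, YoungDiagram.mem_cells, Finset.mem_singleton,
    Prod.mk.injEq]
  constructor
  · rintro ⟨⟨h, _⟩, _⟩
    exact hmem i j h
  · rintro ⟨rfl, rfl⟩
    exact ⟨⟨T.points_subset T.root_mem, fun h => by simpa using hmem _ _ h,
      fun h => by simpa using hmem _ _ h⟩, T.root_mem⟩

theorem finsum_oc (n : ℕ) : ∑ᶠ T ∈ symTableaux (2 * n + 1), T.oc = 2 ^ n * n ! := by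
  cases n with
  | zero =>
    -- The one-cell tableau is separate: its occupied corner is the root, on the diagonal.
    obtain ⟨T, hT⟩ := Set.ncard_eq_one.1 (ncard_symTableaux 0)
    rw [hT, finsum_mem_singleton]
    have : T ∈ symTableaux (2 * 0 + 1) := hT ▸ Set.mem_singleton T
    simpa using oc_of_mem_symTableaux_one this
  | succ n =>
    rw [finsum_mem_eq_of_bijOn 
        (g := fun P : Finset (ℤ × ℤ) => (P.filter fun p => p.1 + p.2 = -1).card) _
        (labelledPoints_bijOn (n + 1)) fun T hT => oc_eq_card hT,
      finsum_mem_coe_finset, sum_allFillings, sum_card_points_add_eq_neg_one, fillingCount_eq]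

end TreeLikeTableau

theorem theorem2 (n : ℕ) :
    (TreeLikeTableau.symTableaux (2 * n + 1)).Finite ∧
    (TreeLikeTableau.symTableaux (2 * n + 1)).ncard = 2 ^ n * n ! ∧
    ∑ᶠ T ∈ TreeLikeTableau.symTableaux (2 * n + 1), T.oc = 2 ^ n * n ! ∧
    ((∑ᶠ T ∈ TreeLikeTableau.symTableaux (2 * n + 1), T.oc : ℕ) : ℚ) /
      ((TreeLikeTableau.symTableaux (2 * n + 1)).ncard : ℚ) = 1 := by
  refine ⟨TreeLikeTableau.finite_symTableaux n, TreeLikeTableau.ncard_symTableaux n,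
    TreeLikeTableau.finsum_oc n, ?_⟩
  rw [TreeLikeTableau.finsum_oc, TreeLikeTableau.ncard_symTableaux]
  exact div_self (by exact_mod_cast (Nat.mul_pos (by positivity) n.factorial_pos).ne')
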